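/- Manifolds and Lie groups are finite-dimensional, smooth, Hausdorff and second countable, and a pseudo-Riemannian metric is a smooth field of non-degenerate symmetric bilinear forms on the tangent spaces. Let $M$ be a connected manifold with base point $P_0$, let $\mathcal H$ be a connected Lie group that acts on $M$, with isotropy group $\mathcal H_0=\{\Phi\in\mathcal H:\Phi P_0=P_0\}$, and let $\lambda:\mathcal H\to\mathbb R$ be a function. For a pseudo-Riemannian metric $g_0$ on $M$, the quadruple $(M,g_0,\mathcal H,\lambda)$ is called a $\mathfrak P$-structure if $\mathcal H$ acts smoothly, transitively and effectively by isometries on $(M,g_0)$, if $\lambda$ is a non-trivial smooth homomorphism from $\mathcal H$ to the multiplicative group $\mathbb R^+$, and if $\mathcal H_0\subset\ker\lambda$. In that case let $M_t:=\lambda^{-1}\{t\}/\mathcal H_0=\{\Phi P_0:\Phi\in\mathcal H,\ \lambda(\Phi)=t\}$ for $t>0$; the metric $g_\lambda$ on $M$ is defined by $g_\lambda(P)=t^2g_0(P)$ for $P\in M_t$. For a pseudo-Riemannian metric $g$ on $M$, we say that $(M,g)$ is homothety homogeneous with homothety character $\lambda$ (with respect to $\mathcal H$) if $\mathcal H$ acts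 smoothly, transitively and effectively on $M$ and if $\lambda(\Phi)>0$ and $\Phi^*g=\lambda(\Phi)^2g$ for all $\Phi\in\mathcal H$. In particular, the group of all homotheties of $(M,g)$ (diffeomorphisms $T$ of $M$ with $T^*g=c^2g$ for some constant $c>0$) then acts transitively on $M$. The manifold $(M,g)$ is called VSI if all its Weyl scalar invariants vanish identically, that is, if every complete contraction (by means of the metric, indices being contracted in pairs) of a tensor product of one or more of the covariant derivatives $\nabla^kR$, $k\ge0$, of the curvature tensor of $g$ is zero on $M$. (1) If $(M,g_0,\mathcal H,\lambda)$ is a $\mathfrak P$-structure, then $g_\lambda$ is a well-defined (smooth) pseudo-Riemannian metric on $M$, and $(M,g_\lambda)$ is homothety homogeneous with homothety character $\lambda$. (2) Conversely, if $(M,g)$ is homothety homogeneous with homothety character $\lambda$, if $\lambda$ is non-trivial (that is, $\lambda\not\equiv1$), and if $(M,g)$ is not VSI, then there is a pseudo-Riemannian metric $g_0$ on $M$ such that $(M,g_0,\mathcal H,\lambda)$ is a $\mathfrak P$-structure and $g=g_\lambda$. -/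

import Mathlib

open scoped Manifold ContDiff Bundle

noncomputable section

/-- A smooth pseudo-Riemannian metric on a manifold `M` modelled on `E`: a smooth field of
symmetric non-degenerate bilinear forms on the tangent spaces. -/
structure PseudoRiemannianMetric (E : Type*) [NormedAddCommGroup E] [NormedSpace ℝ E]
    (M : Type*) [TopologicalSpace M] [ChartedSpace E M] [IsManifold 𝓘(ℝ, E) ∞ M] where
  inner : ∀ p : M, TangentSpace 𝓘(ℝ, E) p →L[ℝ] TangentSpace 𝓘(ℝ, E) p →L[ℝ] ℝ
  symm : ∀ (p : M) (v w : TangentSpace 𝓘(ℝ, E) p), inner p v w = inner p w v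
  nondegenerate : ∀ (p : M) (v : TangentSpace 𝓘(ℝ, E) p), (∀ w, inner p v w = 0) → v = 0
  contMDiff : ContMDiff 𝓘(ℝ, E) (𝓘(ℝ, E).prod 𝓘(ℝ, E →L[ℝ] E →L[ℝ] ℝ)) ∞
    (fun p : M ↦ Bundle.TotalSpace.mk' (E →L[ℝ] E →L[ℝ] ℝ)
      (E := fun p : M ↦ TangentSpace 𝓘(ℝ, E) p →L[ℝ] TangentSpace 𝓘(ℝ, E) p →L[ℝ] ℝ)
      p (inner p))

/-! ### Curvature of a metric in coordinates

`G : E → E →L[ℝ] E →L[ℝ] ℝ` is a field of bilinear forms on (an open subset of) the vector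
space `E`; vectors of `E` are regarded as constant (coordinate) vector fields. -/

section Coordinates

variable {E : Type*} [NormedAddCommGroup E] [NormedSpace ℝ E]

/-- Christoffel symbols of the first kind, as the covector
`w ↦ (1/2) (D_u G (v, w) + D_v G (u, w) - D_w G (u, v))`. -/
def christoffelLower (G : E → E →L[ℝ] E →L[ℝ] ℝ) (x u v : E) : E →L[ℝ] ℝ :=
  (1 / 2 : ℝ) • (fderiv ℝ G x u v + fderiv ℝ G x v u - ((fderiv ℝ G x).flip u).flip v)

/-- Christoffel symbols of the second kind: the vector `∇_u v` at `x`, for the constant vector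
fields `u` and `v` and the Levi-Civita connection `∇` of `G`. -/
def christoffel (G : E → E →L[ℝ] E →L[ℝ] ℝ) (x u v : E) : E :=
  (G x).inverse (christoffelLower G x u v)

/-- The curvature operator `R(u, v) z = ∇_u ∇_v z - ∇_v ∇_u z` at `x`, for constant vector
fields `u, v, z`. -/
def curvatureOperator (G : E → E →L[ℝ] E →L[ℝ] ℝ) (x u v z : E) : E :=
  fderiv ℝ (fun y ↦ christoffel G y v z) x u - fderiv ℝ (fun y ↦ christoffel G y u z) x v
    + christoffel G x u (christoffel G x v z) - christoffel G x v (christoffel G x u z)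

/-- The covariant derivative of a covariant tensor field `T` of rank `k`. The direction of
differentiation is the first argument of the result. -/
def covariantDerivative (G : E → E →L[ℝ] E →L[ℝ] ℝ) {k : ℕ} (T : E → (Fin k → E) → ℝ) :
    E → (Fin (k + 1) → E) → ℝ :=
  fun x v ↦ fderiv ℝ (fun y ↦ T y (Fin.tail v)) x (v 0)
    - ∑ s : Fin k, T x (Function.update (Fin.tail v) s (christoffel G x (v 0) (v s.succ)))

/-- The `k`-th covariant derivative `∇^k R` of the curvature tensor
`R(u, v, z, w) = G(R(u, v) z, w)`. -/
def nablaCurvature (G : E → E →L[ℝ] E →L[ℝ] ℝ) : (k : ℕ) → E → (Fin (4 + k) → E) → ℝ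
  | 0 => fun x v ↦ G x (curvatureOperator G x (v 0) (v 1) (v 2)) (v 3)
  | k + 1 => covariantDerivative G (nablaCurvature G k)

end Coordinates

/-- The combinatorial data of a complete contraction of a product
`∇^{k₁} R ⊗ ⋯ ⊗ ∇^{kₙ} R` with `n ≥ 1`: the `n` orders of differentiation and a decomposition of
the set of all tensor slots (slot `s` of factor `i` being the pair `⟨i, s⟩`) into pairs. The two
slots of pair number `j` are those that correspond to `Sum.inl j` and `Sum.inr j`. -/
structure WeylContraction where
  factors : ℕ
  factors_pos : 0 < factors
  order : Fin factors → ℕ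
  pairs : ℕ
  pairing : (Σ i : Fin factors, Fin (4 + order i)) ≃ Fin pairs ⊕ Fin pairs

/-- The complete contraction described by `c`, at the point `x`, for the metric `G`:
`∑ G^{a₁ b₁} ⋯ G^{a_r b_r} (∇^{k₁} R ⊗ ⋯ ⊗ ∇^{kₙ} R)_{…}`, where the sum is over all the
indices and `G^{ab}` are the entries of the inverse matrix of `(G(e_a, e_b))`, for a basis `e`
of `E`. -/
def WeylContraction.coordValue {E : Type*} [NormedAddCommGroup E] [NormedSpace ℝ E]
    [FiniteDimensional ℝ E] (c : WeylContraction) (G : E → E →L[ℝ] E →L[ℝ] ℝ) (x : E) : ℝ :=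
  let e := Module.finBasis ℝ E
  let Ginv : Matrix _ _ ℝ := (Matrix.of fun a b ↦ G x (e a) (e b))⁻¹
  ∑ a : Fin c.pairs → Fin (Module.finrank ℝ E), ∑ b : Fin c.pairs → Fin (Module.finrank ℝ E),
    (∏ j, Ginv (a j) (b j)) *
      ∏ i, nablaCurvature G (c.order i) x (fun s ↦ e (Sum.elim a b (c.pairing ⟨i, s⟩)))

namespace PseudoRiemannianMetric

variable {E : Type*} [NormedAddCommGroup E] [NormedSpace ℝ E]
  {M : Type*} [TopologicalSpace M] [ChartedSpace E M] [IsManifold 𝓘(ℝ, E) ∞ M]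

/-- The coordinate expression of `g` in the preferred chart at `p`: the pull-back of `g` by the
inverse of that chart. -/
def inChart (g : PseudoRiemannianMetric E M) (p : M) (x : E) : E →L[ℝ] E →L[ℝ] ℝ :=
  ContinuousLinearMap.bilinearComp (E := E) (F := E)
    (g.inner ((extChartAt 𝓘(ℝ, E) p).symm x))
    (mfderiv 𝓘(ℝ, E) 𝓘(ℝ, E) (extChartAt 𝓘(ℝ, E) p).symm x)
    (mfderiv 𝓘(ℝ, E) 𝓘(ℝ, E) (extChartAt 𝓘(ℝ, E) p).symm x)

/-- The Weyl scalar invariant of `g` given by the complete contraction `c`, as a function on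
`M`. -/
def weylScalar [FiniteDimensional ℝ E] (g : PseudoRiemannianMetric E M) (c : WeylContraction)
    (p : M) : ℝ :=
  c.coordValue (g.inChart p) (extChartAt 𝓘(ℝ, E) p p)

/-- Vanishing scalar invariants: all Weyl scalar invariants vanish identically. (These are the
linear combinations of complete contractions, so it suffices to look at the latter.) -/
def IsVSI [FiniteDimensional ℝ E] (g : PseudoRiemannianMetric E M) : Prop :=
  ∀ (c : WeylContraction) (p : M), g.weylScalar c p = 0

/-- `T^* g = c² g`. -/
def PullbackEqSq (g : PseudoRiemannianMetric E M) (T : M → M) (c : ℝ) : Prop :=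
  ∀ (p : M) (v w : TangentSpace 𝓘(ℝ, E) p),
    g.inner (T p) (mfderiv 𝓘(ℝ, E) 𝓘(ℝ, E) T p v) (mfderiv 𝓘(ℝ, E) 𝓘(ℝ, E) T p w)
      = c ^ 2 * g.inner p v w

/-- The group of all homotheties of `(M, g)` acts transitively on `M`. -/
def IsHomothetyHomogeneous (g : PseudoRiemannianMetric E M) : Prop :=
  ∀ p q : M, ∃ T : Diffeomorph 𝓘(ℝ, E) 𝓘(ℝ, E) M M ∞,
    (∃ c : ℝ, 0 < c ∧ g.PullbackEqSq T c) ∧ T p = q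

end PseudoRiemannianMetric

section Action

variable {E : Type*} [NormedAddCommGroup E] [NormedSpace ℝ E]
  {M : Type*} [TopologicalSpace M] [ChartedSpace E M] [IsManifold 𝓘(ℝ, E) ∞ M]
  (F : Type*) [NormedAddCommGroup F] [NormedSpace ℝ F]
  {H : Type*} [TopologicalSpace H] [ChartedSpace F H] [Group H] [MulAction H M]

/-- The Lie group `H` (modelled on `F`) acts smoothly, transitively and effectively on `(M, g)`
by homotheties, and `lam h > 0` is the homothety constant of `h`. -/
structure HasHomothetyCharacter (g : PseudoRiemannianMetric E M) (lam : H → ℝ) : Prop where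
  smooth_action : ContMDiffSMul 𝓘(ℝ, F) 𝓘(ℝ, E) ∞ H M
  transitive : MulAction.IsPretransitive H M
  effective : FaithfulSMul H M
  pos : ∀ h, 0 < lam h
  homothety : ∀ h : H, g.PullbackEqSq (fun p : M ↦ h • p) (lam h)

/-- `(M, g₀, H, lam)` is a `𝔓`-structure with base point `P₀`. -/
structure IsPStructure (g₀ : PseudoRiemannianMetric E M) (lam : H → ℝ) (P₀ : M) : Prop where
  smooth_action : ContMDiffSMul 𝓘(ℝ, F) 𝓘(ℝ, E) ∞ H M
  transitive : MulAction.IsPretransitive H M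
  effective : FaithfulSMul H M
  isometry : ∀ h : H, g₀.PullbackEqSq (fun p : M ↦ h • p) 1
  pos : ∀ h, 0 < lam h
  map_mul : ∀ h k, lam (h * k) = lam h * lam k
  smooth_character : ContMDiff 𝓘(ℝ, F) 𝓘(ℝ, ℝ) ∞ lam
  nontrivial : ∃ h, lam h ≠ 1
  isotropy : ∀ h ∈ MulAction.stabilizer H P₀, lam h = 1

/-- The slice `M_t`: the image of `lam⁻¹{t} / H₀` under the identification `H / H₀ = M` given by
`h ↦ h • P₀`, where `H₀` is the isotropy group of `P₀`. -/
def characterSlice (lam : H → ℝ) (P₀ : M) (t : ℝ) : Set M :=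
  (fun h : H ↦ h • P₀) '' (lam ⁻¹' {t})

/-- `g` is the metric `g_λ` that is equal to `t² g₀` at all points of the slice `M_t`, for
every `t`. -/
def IsRescaling (g₀ : PseudoRiemannianMetric E M) (lam : H → ℝ) (P₀ : M)
    (g : PseudoRiemannianMetric E M) : Prop :=
  ∀ t : ℝ, ∀ p ∈ characterSlice lam P₀ t, g.inner p = t ^ 2 • g₀.inner p

end Action

end

/-!
A homothety `T` with `T^* g = c² g` scales a Weyl scalar `w` made of `ℓ` curvature factors and `m`
contractions by `w = c^(2 (m - ℓ)) (w ∘ T)`, and `m ≥ 2 ℓ > ℓ`, because every factor has at least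
four slots. If `(M, g)` is homothety homogeneous and not VSI, a nonzero Weyl scalar therefore
vanishes nowhere, and `f = (w(P₀) / w)^(1 / (2 (m - ℓ)))` is a smooth positive function with
`f (Φ p) = λ(Φ) f p`. Hence `λ` is a smooth homomorphism that is trivial on the isotropy group, and
`g₀ = f⁻² g` is invariant.

Conversely, the character of a `𝔓`-structure descends to a function `f` on `M` with `g_λ = f² g₀`,
and only the smoothness of `f` is at stake. The orbit map is open and, by equivariance, of constant
rank. By the constant rank theorem its image would locally have smaller dimension if it were not a
submersion; so it has smooth local sections, and `f` is smooth.
-/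

set_option maxSynthPendingDepth 3

section CoordinateMetrics

variable {E V W Z : Type*} [NormedAddCommGroup E] [NormedSpace ℝ E]
  [NormedAddCommGroup V] [NormedSpace ℝ V] [NormedAddCommGroup W] [NormedSpace ℝ W]
  [NormedAddCommGroup Z] [NormedSpace ℝ Z]

theorem fderiv_apply_const {B : E → V →L[ℝ] W} {x : E} (hB : DifferentiableAt ℝ B x)
    (v : V) (u : E) : fderiv ℝ (fun y ↦ B y v) x u = fderiv ℝ B x u v := by
  simp [fderiv_clm_apply hB (differentiableAt_const v)]

theorem fderiv_apply_apply {B : E → V →L[ℝ] W →L[ℝ] Z} {f : E → V} {g : E → W} {x : E}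
    (hB : DifferentiableAt ℝ B x) (hf : DifferentiableAt ℝ f x) (hg : DifferentiableAt ℝ g x)
    (u : E) :
    fderiv ℝ (fun y ↦ B y (f y) (g y)) x u =
      fderiv ℝ B x u (f x) (g x) + B x (fderiv ℝ f x u) (g x) + B x (f x) (fderiv ℝ g x u) := by
  rw [fderiv_clm_apply (hB.clm_apply hf) hg, fderiv_clm_apply hB hf]
  simp only [add_apply, ContinuousLinearMap.coe_comp, Function.comp_apply,
    ContinuousLinearMap.flip_apply]
  abel

theorem fderiv_apply_const_const {B : E → V →L[ℝ] W →L[ℝ] Z} {x : E}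
    (hB : DifferentiableAt ℝ B x) (v : V) (w : W) (u : E) :
    fderiv ℝ (fun y ↦ B y v w) x u = fderiv ℝ B x u v w := by
  simp [fderiv_apply_apply hB (differentiableAt_const v) (differentiableAt_const w)]

theorem differentiableAt_of_contDiffOn {f : E → V} {U : Set E} {x : E}
    (hf : ContDiffOn ℝ ∞ f U) (hU : IsOpen U) (hx : x ∈ U) : DifferentiableAt ℝ f x :=
  (hf.contDiffAt (hU.mem_nhds hx)).differentiableAt (by simp)

/-- A pseudo-Riemannian metric on the open subset `U` of the vector space `E`, in the form used by
`christoffel` and `curvatureOperator`. -/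
structure IsMetricOn (G : E → E →L[ℝ] E →L[ℝ] ℝ) (U : Set E) : Prop where
  isOpen : IsOpen U
  contDiffOn : ContDiffOn ℝ ∞ G U
  symm : ∀ x ∈ U, ∀ u v, G x u v = G x v u
  nondegenerate : ∀ x ∈ U, ∀ u, (∀ v, G x u v = 0) → u = 0

/-- `τ` is a smooth map from the domain `U'` of `G'` to the domain `U` of `G` with
`τ^* G = c² G'`. -/
structure IsHomothetyOn (τ : E → E) (c : ℝ) (G' : E → E →L[ℝ] E →L[ℝ] ℝ) (U' : Set E)
    (G : E → E →L[ℝ] E →L[ℝ] ℝ) (U : Set E) : Prop where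
  contDiffOn : ContDiffOn ℝ ∞ τ U'
  mapsTo : Set.MapsTo τ U' U
  ne_zero : c ≠ 0
  pullback : ∀ y ∈ U', ∀ u v, G (τ y) (fderiv ℝ τ y u) (fderiv ℝ τ y v) = c ^ 2 * G' y u v

/-- The Christoffel symbols of the second kind, bundled as a field of continuous bilinear maps. -/
noncomputable def christoffelMap (G : E → E →L[ℝ] E →L[ℝ] ℝ) (x : E) : E →L[ℝ] E →L[ℝ] E :=
  (ContinuousLinearMap.compL ℝ E (E →L[ℝ] ℝ) E (G x).inverse).comp
    ((1 / 2 : ℝ) • (fderiv ℝ G x + (fderiv ℝ G x).flip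
      - ((ContinuousLinearMap.flipₗᵢ ℝ E E ℝ).toContinuousLinearEquiv :
          (E →L[ℝ] E →L[ℝ] ℝ) →L[ℝ] E →L[ℝ] E →L[ℝ] ℝ).comp (fderiv ℝ G x).flip))

theorem christoffelMap_apply (G : E → E →L[ℝ] E →L[ℝ] ℝ) (x u v : E) :
    christoffelMap G x u v = christoffel G x u v := rfl

namespace IsMetricOn

variable {G : E → E →L[ℝ] E →L[ℝ] ℝ} {U : Set E} {x : E}

theorem mono {U' : Set E} (hG : IsMetricOn G U) (hU' : IsOpen U') (h : U' ⊆ U) :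
    IsMetricOn G U' where
  isOpen := hU'
  contDiffOn := hG.contDiffOn.mono h
  symm x hx := hG.symm x (h hx)
  nondegenerate x hx := hG.nondegenerate x (h hx)

theorem differentiableAt (hG : IsMetricOn G U) (hx : x ∈ U) : DifferentiableAt ℝ G x :=
  differentiableAt_of_contDiffOn hG.contDiffOn hG.isOpen hx

variable [FiniteDimensional ℝ E]

theorem isInvertible (hG : IsMetricOn G U) (hx : x ∈ U) : (G x).IsInvertible := by
  have hinj : Function.Injective (G x : E →ₗ[ℝ] E →L[ℝ] ℝ) := by
    rw [injective_iff_map_eq_zero]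
    exact fun u hu ↦ hG.nondegenerate x hx u fun v ↦ DFunLike.congr_fun hu v
  have hdim : Module.finrank ℝ E = Module.finrank ℝ (E →L[ℝ] ℝ) := by
    rw [← (LinearMap.toContinuousLinearMap (𝕜 := ℝ) (E := E) (F' := ℝ)).finrank_eq]
    exact Subspace.dual_finrank_eq.symm
  exact ⟨(LinearEquiv.ofInjectiveOfFinrankEq _ hinj hdim).toContinuousLinearEquiv, rfl⟩

theorem apply_christoffel (hG : IsMetricOn G U) (hx : x ∈ U) (u v w : E) :
    G x (christoffel G x u v) w = (1 / 2 : ℝ) *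
      (fderiv ℝ G x u v w + fderiv ℝ G x v u w - fderiv ℝ G x w u v) := by
  rw [christoffel, (hG.isInvertible hx).self_apply_inverse]
  simp [christoffelLower]

set_option synthInstance.maxHeartbeats 80000 in
-- normed structures on iterated spaces of continuous linear maps are slow to synthesize
theorem contDiffOn_christoffelMap (hG : IsMetricOn G U) :
    ContDiffOn ℝ ∞ (christoffelMap G) U := by
  have hinv : ContDiffOn ℝ ∞ (fun x ↦ (G x).inverse) U := fun x hx ↦
    (hG.isInvertible hx).contDiffAt_map_inverse.comp_contDiffWithinAt x (hG.contDiffOn x hx)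
  have hD : ContDiffOn ℝ ∞ (fderiv ℝ G) U := hG.contDiffOn.fderiv_of_isOpen hG.isOpen le_rfl
  have hflip : ContDiffOn ℝ ∞ (fun x ↦ (fderiv ℝ G x).flip) U :=
    (ContinuousLinearMap.flipₗᵢ ℝ E E (E →L[ℝ] ℝ)).contDiff.comp_contDiffOn hD
  exact ((ContinuousLinearMap.contDiff _).comp_contDiffOn hinv).clm_comp
    (((hD.add hflip).sub (contDiffOn_const.clm_comp hflip)).const_smul _)

theorem differentiableAt_christoffelMap (hG : IsMetricOn G U) (hx : x ∈ U) :
    DifferentiableAt ℝ (christoffelMap G) x :=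
  differentiableAt_of_contDiffOn hG.contDiffOn_christoffelMap hG.isOpen hx

theorem fderiv_christoffel (hG : IsMetricOn G U) (hx : x ∈ U) (u v z : E) :
    fderiv ℝ (fun y ↦ christoffel G y v z) x u = fderiv ℝ (christoffelMap G) x u v z := by
  simp only [← christoffelMap_apply]
  exact fderiv_apply_const_const (hG.differentiableAt_christoffelMap hx) v z u

end IsMetricOn

namespace IsHomothetyOn

variable {τ : E → E} {c : ℝ} {G' G : E → E →L[ℝ] E →L[ℝ] ℝ} {U' U : Set E} {y : E}

theorem contDiffOn_fderiv (hτ : IsHomothetyOn τ c G' U' G U) (hU' : IsOpen U') :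
    ContDiffOn ℝ ∞ (fderiv ℝ τ) U' :=
  hτ.contDiffOn.fderiv_of_isOpen hU' le_rfl

theorem differentiableAt (hτ : IsHomothetyOn τ c G' U' G U) (hU' : IsOpen U') (hy : y ∈ U') :
    DifferentiableAt ℝ τ y :=
  differentiableAt_of_contDiffOn hτ.contDiffOn hU' hy

theorem differentiableAt_fderiv (hτ : IsHomothetyOn τ c G' U' G U) (hU' : IsOpen U')
    (hy : y ∈ U') : DifferentiableAt ℝ (fderiv ℝ τ) y :=
  differentiableAt_of_contDiffOn (hτ.contDiffOn_fderiv hU') hU' hy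

theorem fderiv_fderiv_symm (hτ : IsHomothetyOn τ c G' U' G U) (hU' : IsOpen U')
    (hy : y ∈ U') (u v : E) :
    fderiv ℝ (fderiv ℝ τ) y u v = fderiv ℝ (fderiv ℝ τ) y v u :=
  (hτ.contDiffOn.contDiffAt (hU'.mem_nhds hy)).isSymmSndFDerivAt
    (by simpa using ENat.LEInfty.out) u v

theorem fderiv_fderiv_fderiv_symm (hτ : IsHomothetyOn τ c G' U' G U) (hU' : IsOpen U')
    (hy : y ∈ U') (u v w : E) :
    fderiv ℝ (fderiv ℝ (fderiv ℝ τ)) y u v w = fderiv ℝ (fderiv ℝ (fderiv ℝ τ)) y v u w := by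
  rw [((hτ.contDiffOn_fderiv hU').contDiffAt (hU'.mem_nhds hy)).isSymmSndFDerivAt
    (by simpa using ENat.LEInfty.out) u v]

theorem fderiv_metric (hτ : IsHomothetyOn τ c G' U' G U) (hG' : IsMetricOn G' U')
    (hG : IsMetricOn G U) (hy : y ∈ U') (u v w : E) :
    c ^ 2 * fderiv ℝ G' y u v w =
      fderiv ℝ G (τ y) (fderiv ℝ τ y u) (fderiv ℝ τ y v) (fderiv ℝ τ y w)
      + G (τ y) (fderiv ℝ (fderiv ℝ τ) y u v) (fderiv ℝ τ y w)
      + G (τ y) (fderiv ℝ τ y v) (fderiv ℝ (fderiv ℝ τ) y u w) := by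
  have hDτ := hτ.differentiableAt_fderiv hG'.isOpen hy
  have hGy := hG.differentiableAt (hτ.mapsTo hy)
  have hτy := hτ.differentiableAt hG'.isOpen hy
  have hG'y := hG'.differentiableAt hy
  have hpull : (fun z ↦ c ^ 2 * G' z v w) =ᶠ[nhds y]
      fun z ↦ G (τ z) (fderiv ℝ τ z v) (fderiv ℝ τ z w) :=
    Filter.eventuallyEq_of_mem (hG'.isOpen.mem_nhds hy) fun z hz ↦ (hτ.pullback z hz v w).symm
  have h := DFunLike.congr_fun (hpull.fderiv_eq (𝕜 := ℝ)) u
  rw [fderiv_const_mul (by fun_prop), smul_apply, fderiv_apply_const_const hG'y,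
    fderiv_apply_apply (hGy.fun_comp' y hτy) (hDτ.clm_apply (differentiableAt_const v))
      (hDτ.clm_apply (differentiableAt_const w)), fderiv_fun_comp y hGy hτy,
    fderiv_apply_const hDτ, fderiv_apply_const hDτ] at h
  exact h

variable [FiniteDimensional ℝ E]

theorem bijective_fderiv (hτ : IsHomothetyOn τ c G' U' G U) (hG' : IsMetricOn G' U')
    (hy : y ∈ U') : Function.Bijective (fderiv ℝ τ y) := by
  have hinj : Function.Injective (fderiv ℝ τ y) := by
    rw [injective_iff_map_eq_zero]
    refine fun u hu ↦ hG'.nondegenerate y hy u fun v ↦ ?_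
    simpa [hu, hτ.ne_zero] using (hτ.pullback y hy u v).symm
  exact ⟨hinj, LinearMap.surjective_of_injective (f := (fderiv ℝ τ y : E →ₗ[ℝ] E)) hinj⟩

theorem fderiv_christoffel_eq (hτ : IsHomothetyOn τ c G' U' G U) (hG' : IsMetricOn G' U')
    (hG : IsMetricOn G U) (hy : y ∈ U') (u v : E) :
    fderiv ℝ τ y (christoffel G' y u v) =
      christoffel G (τ y) (fderiv ℝ τ y u) (fderiv ℝ τ y v) + fderiv ℝ (fderiv ℝ τ) y u v := by
  have hτy := hτ.mapsTo hy
  have hsymm := hG.symm _ hτy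
  have hB := hτ.fderiv_fderiv_symm hG'.isOpen hy
  rw [← sub_eq_zero]
  refine hG.nondegenerate _ hτy _ fun w' ↦ ?_
  obtain ⟨w, rfl⟩ := (hτ.bijective_fderiv hG' hy).surjective w'
  have h1 := hτ.fderiv_metric hG' hG hy u v w
  have h2 := hτ.fderiv_metric hG' hG hy v u w
  have h3 := hτ.fderiv_metric hG' hG hy w u v
  rw [hsymm (fderiv ℝ τ y v)] at h1
  rw [hB v u, hsymm (fderiv ℝ τ y u)] at h2
  rw [hB w u, hB w v, hsymm (fderiv ℝ τ y u)] at h3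
  simp only [map_sub, map_add, sub_apply, add_apply, hG.apply_christoffel hτy,
    hτ.pullback y hy, hG'.apply_christoffel hy]
  linear_combination (1 / 2 : ℝ) * (h1 + h2 - h3)

theorem fderiv_fderiv_christoffelMap_eq (hτ : IsHomothetyOn τ c G' U' G U)
    (hG' : IsMetricOn G' U') (hG : IsMetricOn G U) (hy : y ∈ U') (u v z : E) :
    fderiv ℝ (fderiv ℝ τ) y u (christoffelMap G' y v z)
      + fderiv ℝ τ y (fderiv ℝ (christoffelMap G') y u v z)
      = fderiv ℝ (christoffelMap G) (τ y) (fderiv ℝ τ y u) (fderiv ℝ τ y v) (fderiv ℝ τ y z)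
        + christoffelMap G (τ y) (fderiv ℝ (fderiv ℝ τ) y u v) (fderiv ℝ τ y z)
        + christoffelMap G (τ y) (fderiv ℝ τ y v) (fderiv ℝ (fderiv ℝ τ) y u z)
        + fderiv ℝ (fderiv ℝ (fderiv ℝ τ)) y u v z := by
  have hτy := hτ.differentiableAt hG'.isOpen hy
  have hDτ := hτ.differentiableAt_fderiv hG'.isOpen hy
  have hD2τ : DifferentiableAt ℝ (fderiv ℝ (fderiv ℝ τ)) y :=
    differentiableAt_of_contDiffOn ((hτ.contDiffOn_fderiv hG'.isOpen).fderiv_of_isOpen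
      (n := ∞) (m := ∞) hG'.isOpen le_rfl) hG'.isOpen hy
  have hΓ' := hG'.differentiableAt_christoffelMap hy
  have hΓ := hG.differentiableAt_christoffelMap (hτ.mapsTo hy)
  have hDτv := hDτ.clm_apply (differentiableAt_const v)
  have hDτz := hDτ.clm_apply (differentiableAt_const z)
  have hlaw : (fun x ↦ fderiv ℝ τ x (christoffelMap G' x v z)) =ᶠ[nhds y]
      fun x ↦ christoffelMap G (τ x) (fderiv ℝ τ x v) (fderiv ℝ τ x z)
        + fderiv ℝ (fderiv ℝ τ) x v z :=
    Filter.eventuallyEq_of_mem (hG'.isOpen.mem_nhds hy)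
      fun x hx ↦ hτ.fderiv_christoffel_eq hG' hG hx v z
  have h := DFunLike.congr_fun (hlaw.fderiv_eq (𝕜 := ℝ)) u
  rw [fderiv_clm_apply hDτ (by fun_prop), fderiv_fun_add
      (((hΓ.fun_comp' y hτy).clm_apply hDτv).clm_apply hDτz) (by fun_prop), add_apply, add_apply,
    ContinuousLinearMap.comp_apply, ContinuousLinearMap.flip_apply,
    fderiv_apply_const_const hΓ', fderiv_apply_const_const hD2τ,
    fderiv_apply_apply (hΓ.fun_comp' y hτy) hDτv hDτz, fderiv_fun_comp y hΓ hτy,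
    fderiv_apply_const hDτ, fderiv_apply_const hDτ] at h
  rw [add_comm]
  exact h

theorem fderiv_curvatureOperator (hτ : IsHomothetyOn τ c G' U' G U) (hG' : IsMetricOn G' U')
    (hG : IsMetricOn G U) (hy : y ∈ U') (u v z : E) :
    fderiv ℝ τ y (curvatureOperator G' y u v z) =
      curvatureOperator G (τ y) (fderiv ℝ τ y u) (fderiv ℝ τ y v) (fderiv ℝ τ y z) := by
  have huv := hτ.fderiv_fderiv_christoffelMap_eq hG' hG hy u v z
  have hvu := hτ.fderiv_fderiv_christoffelMap_eq hG' hG hy v u z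
  rw [hτ.fderiv_fderiv_symm hG'.isOpen hy v u,
    hτ.fderiv_fderiv_fderiv_symm hG'.isOpen hy v u] at hvu
  simp only [curvatureOperator, hG.fderiv_christoffel (hτ.mapsTo hy), hG'.fderiv_christoffel hy,
    map_sub, map_add, hτ.fderiv_christoffel_eq hG' hG hy]
  simp only [← christoffelMap_apply, map_add] at huv hvu ⊢
  linear_combination (norm := module) huv - hvu

end IsHomothetyOn

end CoordinateMetrics

section TensorFields

variable {E : Type*} [NormedAddCommGroup E] [NormedSpace ℝ E]

/-- `T` is a smooth covariant tensor field of rank `k` on `U`: on `U` it agrees with a smooth field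
of continuous multilinear maps. -/
def IsTensorFieldOn {k : ℕ} (T : E → (Fin k → E) → ℝ) (U : Set E) : Prop :=
  ∃ S : E → E [×k]→L[ℝ] ℝ, ContDiffOn ℝ ∞ S U ∧ ∀ x ∈ U, ⇑(S x) = T x

theorem IsTensorFieldOn.contDiffOn_apply {k : ℕ} {T : E → (Fin k → E) → ℝ} {U : Set E}
    (hT : IsTensorFieldOn T U) (v : Fin k → E) : ContDiffOn ℝ ∞ (fun x ↦ T x v) U := by
  obtain ⟨S, hS, hST⟩ := hT
  exact ((ContinuousMultilinearMap.apply ℝ (fun _ ↦ E) ℝ v).contDiff.comp_contDiffOn hS).congr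
    fun x hx ↦ (congrFun (hST x hx) v).symm

/-- The action of an endomorphism `B` as a derivation on covariant tensors of rank `k`:
`T ↦ ∑ s, T (…, B vₛ, …)`. -/
noncomputable def derivationAction (E : Type*) [NormedAddCommGroup E] [NormedSpace ℝ E] (k : ℕ) :
    (E →L[ℝ] E) →L[ℝ] (E [×k]→L[ℝ] ℝ) →L[ℝ] E [×k]→L[ℝ] ℝ :=
  ((ContinuousMultilinearMap.compContinuousLinearMapContinuousMultilinear ℝ (fun _ : Fin k ↦ E)
    (fun _ ↦ E) ℝ).linearDeriv fun _ ↦ .id ℝ E) ∘L ContinuousLinearMap.pi fun _ ↦ .id ℝ (E →L[ℝ] E)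

theorem derivationAction_apply {k : ℕ} (B : E →L[ℝ] E) (T : E [×k]→L[ℝ] ℝ) (v : Fin k → E) :
    derivationAction E k B T v = ∑ s, T (Function.update v s (B (v s))) := by
  have hupdate (s : Fin k) :
      (fun i ↦ (Function.update (fun _ ↦ .id ℝ E) s B : Fin k → E →L[ℝ] E) i (v i)) =
        Function.update v s (B (v s)) := by
    ext i
    rcases eq_or_ne i s with rfl | h <;> simp [*]
  simp [derivationAction, ContinuousMultilinearMap.linearDeriv_apply, hupdate]

theorem covariantDerivative_eq_of_eventuallyEq {G : E → E →L[ℝ] E →L[ℝ] ℝ} {k : ℕ}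
    {T : E → (Fin k → E) → ℝ} {S : E → E [×k]→L[ℝ] ℝ} {x : E} (hS : DifferentiableAt ℝ S x)
    (hST : ∀ᶠ y in nhds x, ⇑(S y) = T y) (v : Fin (k + 1) → E) :
    covariantDerivative G T x v = fderiv ℝ S x (v 0) (Fin.tail v)
      - ∑ s, S x (Function.update (Fin.tail v) s (christoffel G x (v 0) (Fin.tail v s))) := by
  have hT : (fun y ↦ T y (Fin.tail v)) =ᶠ[nhds x] fun y ↦ S y (Fin.tail v) :=
    hST.mono fun y hy ↦ (congrFun hy _).symm
  rw [covariantDerivative, hT.fderiv_eq, ← hST.self_of_nhds,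
    fderiv_continuousMultilinear_apply_const_apply hS]
  rfl

theorem IsTensorFieldOn.covariantDerivative [FiniteDimensional ℝ E]
    {G : E → E →L[ℝ] E →L[ℝ] ℝ} {U : Set E} {k : ℕ} {T : E → (Fin k → E) → ℝ}
    (hT : IsTensorFieldOn T U) (hG : IsMetricOn G U) :
    IsTensorFieldOn (covariantDerivative G T) U := by
  obtain ⟨S, hS, hST⟩ := hT
  refine ⟨fun x ↦ (continuousMultilinearCurryLeftEquiv ℝ (fun _ : Fin (k + 1) ↦ E) ℝ).symm
    (fderiv ℝ S x - ((derivationAction E k).flip (S x)).comp (christoffelMap G x)), ?_,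
    fun x hx ↦ funext fun v ↦ ?_⟩
  · refine (LinearIsometryEquiv.contDiff _).comp_contDiffOn ?_
    exact (hS.fderiv_of_isOpen hG.isOpen le_rfl).sub
      (((ContinuousLinearMap.contDiff _).comp_contDiffOn hS).clm_comp hG.contDiffOn_christoffelMap)
  · rw [covariantDerivative_eq_of_eventuallyEq (differentiableAt_of_contDiffOn hS hG.isOpen hx)
      (Filter.eventually_of_mem (hG.isOpen.mem_nhds hx) hST)]
    simp [derivationAction_apply, christoffelMap_apply, Fin.tail]

theorem fderiv_multilinear_comp {k : ℕ} {τ : E → E} {S : E → E [×k]→L[ℝ] ℝ} {y : E}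
    (hS : DifferentiableAt ℝ S (τ y)) (hτ : DifferentiableAt ℝ τ y)
    (hDτ : DifferentiableAt ℝ (fderiv ℝ τ) y) (v : Fin k → E) (u : E) :
    fderiv ℝ (fun z ↦ S (τ z) fun i ↦ fderiv ℝ τ z (v i)) y u =
      fderiv ℝ S (τ y) (fderiv ℝ τ y u) (fun i ↦ fderiv ℝ τ y (v i))
      + ∑ s, S (τ y) (Function.update (fun i ↦ fderiv ℝ τ y (v i)) s
          (fderiv ℝ (fderiv ℝ τ) y u (v s))) := by
  have h := (hS.hasFDerivAt.comp y hτ.hasFDerivAt).continuousMultilinearMap_apply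
    fun i ↦ hDτ.hasFDerivAt.clm_apply (hasFDerivAt_const (v i) y)
  simp only [Function.comp_apply] at h
  simp [h.fderiv]

theorem IsHomothetyOn.sum_update_christoffel_eq [FiniteDimensional ℝ E] {τ : E → E} {c : ℝ}
    {G' G : E → E →L[ℝ] E →L[ℝ] ℝ} {U' U : Set E} {k : ℕ} (hτ : IsHomothetyOn τ c G' U' G U)
    (hG' : IsMetricOn G' U') (hG : IsMetricOn G U) {y : E} (hy : y ∈ U') (S : E [×k]→L[ℝ] ℝ)
    (u : E) (w : Fin k → E) :
    ∑ s, S (fun i ↦ fderiv ℝ τ y (Function.update w s (christoffel G' y u (w s)) i)) =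
      ∑ s, S (Function.update (fun i ↦ fderiv ℝ τ y (w i)) s
        (christoffel G (τ y) (fderiv ℝ τ y u) (fderiv ℝ τ y (w s))))
      + ∑ s, S (Function.update (fun i ↦ fderiv ℝ τ y (w i)) s
        (fderiv ℝ (fderiv ℝ τ) y u (w s))) := by
  have hcomp (s : Fin k) (z : E) : (fun i ↦ fderiv ℝ τ y (Function.update w s z i)) =
      Function.update (fun i ↦ fderiv ℝ τ y (w i)) s (fderiv ℝ τ y z) :=
    Function.comp_update (fderiv ℝ τ y) w s z
  simp only [hcomp, hτ.fderiv_christoffel_eq hG' hG hy, ContinuousMultilinearMap.map_update_add,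
    Finset.sum_add_distrib]

theorem IsHomothetyOn.covariantDerivative_eq [FiniteDimensional ℝ E] {τ : E → E} {c μ : ℝ}
    {G' G : E → E →L[ℝ] E →L[ℝ] ℝ} {U' U : Set E} {k : ℕ} {T' T : E → (Fin k → E) → ℝ}
    (hτ : IsHomothetyOn τ c G' U' G U) (hG' : IsMetricOn G' U') (hG : IsMetricOn G U)
    (hT : IsTensorFieldOn T U)
    (h : ∀ y ∈ U', ∀ v, T' y v = μ * T (τ y) fun i ↦ fderiv ℝ τ y (v i))
    {y : E} (hy : y ∈ U') (v : Fin (k + 1) → E) :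
    covariantDerivative G' T' y v =
      μ * covariantDerivative G T (τ y) fun i ↦ fderiv ℝ τ y (v i) := by
  obtain ⟨S, hS, hST⟩ := hT
  have hUy := hG.isOpen.mem_nhds (hτ.mapsTo hy)
  have hSy := differentiableAt_of_contDiffOn hS hG.isOpen (hτ.mapsTo hy)
  have hT'S : ∀ z ∈ U', ∀ v, T' z v = μ * S (τ z) fun i ↦ fderiv ℝ τ z (v i) := fun z hz v ↦ by
    rw [h z hz, hST _ (hτ.mapsTo hz)]
  have hT' : (fun z ↦ T' z (Fin.tail v)) =ᶠ[nhds y]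
      μ • fun z ↦ S (τ z) fun i ↦ fderiv ℝ τ z (Fin.tail v i) :=
    Filter.eventually_of_mem (hG'.isOpen.mem_nhds hy) fun z hz ↦ hT'S z hz _
  have htail : (Fin.tail fun i ↦ fderiv ℝ τ y (v i)) = fun i ↦ fderiv ℝ τ y (Fin.tail v i) := rfl
  have hsum := hτ.sum_update_christoffel_eq hG' hG hy (S (τ y)) (v 0) (Fin.tail v)
  rw [covariantDerivative_eq_of_eventuallyEq hSy (Filter.eventually_of_mem hUy hST),
    covariantDerivative, hT'.fderiv_eq, fderiv_const_smul_field, Pi.smul_apply, smul_apply,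
    fderiv_multilinear_comp hSy (hτ.differentiableAt hG'.isOpen hy)
      (hτ.differentiableAt_fderiv hG'.isOpen hy), htail]
  have hsucc (s : Fin k) : v s.succ = Fin.tail v s := rfl
  simp only [hT'S y hy, hsucc, ← Finset.mul_sum, smul_eq_mul, hsum]
  ring

/-- Uncurrying on the left after a linear map `e` that regards elements of `W` as tensors of rank
`k`. -/
noncomputable def uncurryLeftComp {W : Type*} [NormedAddCommGroup W] [NormedSpace ℝ W] {k : ℕ}
    (e : W →L[ℝ] E [×k]→L[ℝ] ℝ) : (E →L[ℝ] W) →L[ℝ] E [×(k + 1)]→L[ℝ] ℝ :=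
  ((continuousMultilinearCurryLeftEquiv ℝ (fun _ : Fin (k + 1) ↦ E)
    ℝ).symm.toContinuousLinearEquiv.toContinuousLinearMap).comp
      (ContinuousLinearMap.compL ℝ E W (E [×k]→L[ℝ] ℝ) e)

/-- A fourfold curried form, regarded as a tensor of rank `4`. -/
noncomputable def uncurryFour :
    (E →L[ℝ] E →L[ℝ] E →L[ℝ] E →L[ℝ] ℝ) →L[ℝ] E [×4]→L[ℝ] ℝ :=
  uncurryLeftComp <| uncurryLeftComp <| uncurryLeftComp <|
    (continuousMultilinearCurryFin1 ℝ E ℝ).symm.toContinuousLinearEquiv.toContinuousLinearMap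

/-- The part `(u, v, z) ↦ (D_u Γ)(v, z) + Γ(u, Γ(v, z))` of the curvature, whose antisymmetrization
in `u` and `v` is the curvature operator. -/
noncomputable def curvatureHalf (G : E → E →L[ℝ] E →L[ℝ] ℝ) (x : E) :
    E →L[ℝ] E →L[ℝ] E →L[ℝ] E :=
  fderiv ℝ (christoffelMap G) x +
    (((ContinuousLinearMap.compL ℝ E E E).comp (christoffelMap G x)).flip.comp
      (christoffelMap G x)).flip

variable [FiniteDimensional ℝ E] {G : E → E →L[ℝ] E →L[ℝ] ℝ} {U : Set E}

theorem IsMetricOn.curvatureOperator_eq (hG : IsMetricOn G U) {x : E} (hx : x ∈ U) (u v z : E) :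
    curvatureOperator G x u v z = curvatureHalf G x u v z - curvatureHalf G x v u z := by
  simp only [curvatureOperator, hG.fderiv_christoffel hx, curvatureHalf, add_apply,
    ContinuousLinearMap.flip_apply, ContinuousLinearMap.comp_apply, ContinuousLinearMap.compL_apply,
    christoffelMap_apply]
  abel

theorem IsMetricOn.contDiffOn_curvatureHalf (hG : IsMetricOn G U) :
    ContDiffOn ℝ ∞ (curvatureHalf G) U := by
  have hΓ := hG.contDiffOn_christoffelMap
  have hcomp : ContDiffOn ℝ ∞
      (fun x ↦ ((ContinuousLinearMap.compL ℝ E E E).comp (christoffelMap G x)).flip) U :=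
    (ContinuousLinearMap.flipₗᵢ ℝ E (E →L[ℝ] E) (E →L[ℝ] E)).contDiff.comp_contDiffOn
      (contDiffOn_const.clm_comp hΓ)
  exact (hΓ.fderiv_of_isOpen hG.isOpen le_rfl).add
    ((ContinuousLinearMap.flipₗᵢ ℝ E E (E →L[ℝ] E)).contDiff.comp_contDiffOn (hcomp.clm_comp hΓ))

set_option synthInstance.maxHeartbeats 200000 in
-- normed structures on iterated spaces of continuous linear maps are slow to synthesize
theorem IsMetricOn.isTensorFieldOn_curvature (hG : IsMetricOn G U) :
    IsTensorFieldOn (nablaCurvature G 0) U := by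
  let lower (x : E) : (E →L[ℝ] E →L[ℝ] E) →L[ℝ] E →L[ℝ] E →L[ℝ] E →L[ℝ] ℝ :=
    ContinuousLinearMap.compL ℝ E (E →L[ℝ] E) (E →L[ℝ] E →L[ℝ] ℝ)
      (ContinuousLinearMap.compL ℝ E E (E →L[ℝ] ℝ) (G x))
  have hlower : ContDiffOn ℝ ∞ lower U :=
    (ContinuousLinearMap.contDiff _).comp_contDiffOn
      ((ContinuousLinearMap.contDiff _).comp_contDiffOn hG.contDiffOn)
  have hcurv : ContDiffOn ℝ ∞ (fun x ↦ curvatureHalf G x - (curvatureHalf G x).flip) U :=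
    hG.contDiffOn_curvatureHalf.sub
      ((ContinuousLinearMap.flipₗᵢ ℝ E E (E →L[ℝ] E)).contDiff.comp_contDiffOn
        hG.contDiffOn_curvatureHalf)
  refine ⟨fun x ↦ uncurryFour ((lower x).comp (curvatureHalf G x - (curvatureHalf G x).flip)),
    (ContinuousLinearMap.contDiff _).comp_contDiffOn (hlower.clm_comp hcurv),
    fun x hx ↦ funext fun v ↦ ?_⟩
  simp only [nablaCurvature, hG.curvatureOperator_eq hx]
  rfl

theorem IsMetricOn.isTensorFieldOn_nablaCurvature (hG : IsMetricOn G U) (k : ℕ) :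
    IsTensorFieldOn (nablaCurvature G k) U := by
  induction k with
  | zero => exact hG.isTensorFieldOn_curvature
  | succ k ih => exact ih.covariantDerivative hG

theorem IsHomothetyOn.nablaCurvature_eq {τ : E → E} {c : ℝ} {G' : E → E →L[ℝ] E →L[ℝ] ℝ}
    {U' : Set E} (hτ : IsHomothetyOn τ c G' U' G U) (hG' : IsMetricOn G' U')
    (hG : IsMetricOn G U) (k : ℕ) {y : E} (hy : y ∈ U') (v : Fin (4 + k) → E) :
    nablaCurvature G' k y v =
      (c ^ 2)⁻¹ * nablaCurvature G k (τ y) fun i ↦ fderiv ℝ τ y (v i) := by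
  induction k generalizing y with
  | zero =>
    simp only [nablaCurvature, ← hτ.fderiv_curvatureOperator hG' hG hy, hτ.pullback y hy]
    rw [inv_mul_cancel_left₀ (pow_ne_zero 2 hτ.ne_zero)]
  | succ k ih =>
    exact hτ.covariantDerivative_eq hG' hG (hG.isTensorFieldOn_nablaCurvature k)
      (fun z hz w ↦ ih hz w) hy v

end TensorFields

section Contraction

section Algebra

variable {R E ι κ : Type*} [CommRing R] [AddCommGroup E] [Module R E] [Fintype ι] [Fintype κ]
  [DecidableEq κ]

theorem multilinear_sumElim_sum_smul
    (Φ : MultilinearMap R (fun _ : κ ⊕ κ ↦ E) R) (e : ι → E) (A B : κ → ι → R) :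
    Φ (Sum.elim (fun j ↦ ∑ i, A j i • e i) fun j ↦ ∑ i, B j i • e i) =
      ∑ a : κ → ι, ∑ b : κ → ι, (∏ j, A j (a j) * B j (b j)) * Φ (e ∘ Sum.elim a b) := by
  have h : Sum.elim (fun j ↦ ∑ i, A j i • e i) (fun j ↦ ∑ i, B j i • e i) =
      fun s ↦ ∑ i, Sum.elim A B s i • e i := by
    ext (j | j) <;> rfl
  rw [h, MultilinearMap.map_sum, ← (Equiv.sumArrowEquivProdArrow κ κ ι).symm.sum_comp,
    Fintype.sum_prod_type]
  simp only [MultilinearMap.map_smul_univ, Fintype.prod_sum_type,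
    Equiv.sumArrowEquivProdArrow_symm_apply_inl, Equiv.sumArrowEquivProdArrow_symm_apply_inr,
    Sum.elim_inl, Sum.elim_inr, smul_eq_mul, Finset.prod_mul_distrib]
  rfl

theorem prod_sum_sum_eq_sum_sum_prod (f : κ → ι → ι → R) :
    ∏ j, ∑ a, ∑ b, f j a b = ∑ a : κ → ι, ∑ b : κ → ι, ∏ j, f j (a j) (b j) := by
  simp only [Finset.prod_univ_sum, Fintype.piFinset_univ]

/-- The complete contraction of a tensor `Φ`, whose slots come in pairs `inl j`, `inr j`, with the
matrix `g` of a form on the dual space with respect to the basis `e`. -/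
def contractPairs (g : Matrix ι ι R) (Φ : MultilinearMap R (fun _ : κ ⊕ κ ↦ E) R) (e : ι → E) : R :=
  ∑ a : κ → ι, ∑ b : κ → ι, (∏ j, g (a j) (b j)) * Φ (e ∘ Sum.elim a b)

theorem contractPairs_compLinearMap [DecidableEq ι] (e : Module.Basis ι R E) (f : E →ₗ[R] E)
    (Φ : MultilinearMap R (fun _ : κ ⊕ κ ↦ E) R) (g : Matrix ι ι R) :
    contractPairs g (Φ.compLinearMap fun _ ↦ f) e =
      contractPairs (f.toMatrix e e * g * (f.toMatrix e e).transpose) Φ e := by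
  set A := f.toMatrix e e with hA
  have hf (i : ι) : f (e i) = ∑ k, A k i • e k := by
    simp [hA, LinearMap.toMatrix_apply]
  have hΦ (a' b' : κ → ι) : Φ.compLinearMap (fun _ ↦ f) (e ∘ Sum.elim a' b') =
      ∑ a, ∑ b, (∏ j, A (a j) (a' j) * A (b j) (b' j)) * Φ (e ∘ Sum.elim a b) := by
    rw [← multilinear_sumElim_sum_smul Φ e (fun j i ↦ A i (a' j)) fun j i ↦ A i (b' j),
      MultilinearMap.compLinearMap_apply]
    congr 1
    ext (j | j) <;> exact hf _
  have hmatrix (a b : κ → ι) : ∏ j, (A * g * A.transpose) (a j) (b j) = ∑ a' : κ → ι,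
      ∑ b' : κ → ι, (∏ j, g (a' j) (b' j)) * ∏ j, A (a j) (a' j) * A (b j) (b' j) := by
    simp only [← Finset.prod_mul_distrib]
    rw [← prod_sum_sum_eq_sum_sum_prod
      fun j a' b' ↦ g a' b' * (A (a j) a' * A (b j) b')]
    refine Finset.prod_congr rfl fun j _ ↦ ?_
    simp only [Matrix.mul_apply, Matrix.transpose_apply, Finset.sum_mul]
    rw [Finset.sum_comm]
    exact Finset.sum_congr rfl fun _ _ ↦ Finset.sum_congr rfl fun _ _ ↦ by ring
  simp only [contractPairs, hΦ, hmatrix, Finset.mul_sum, Finset.sum_mul, ← mul_assoc]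
  rw [Finset.sum_comm_cycle]
  exact Finset.sum_congr rfl fun a _ ↦ Finset.sum_comm_cycle

theorem contractPairs_smul (t : R) (g : Matrix ι ι R)
    (Φ : MultilinearMap R (fun _ : κ ⊕ κ ↦ E) R) (e : ι → E) :
    contractPairs (t • g) Φ e = t ^ Fintype.card κ * contractPairs g Φ e := by
  simp [contractPairs, Finset.prod_mul_distrib, Finset.mul_sum, mul_assoc]

theorem contractPairs_smul_right (t : R) (g : Matrix ι ι R)
    (Φ : MultilinearMap R (fun _ : κ ⊕ κ ↦ E) R) (e : ι → E) :
    contractPairs g (t • Φ) e = t * contractPairs g Φ e := by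
  simp [contractPairs, Finset.mul_sum, mul_left_comm]

end Algebra

theorem mul_inv_mul_transpose_of_congruence {ι K : Type*} [Fintype ι] [DecidableEq ι] [Field K]
    {A g g' : Matrix ι ι K} {t : K} (hA : IsUnit A.det) (hg' : IsUnit g'.det) (ht : t ≠ 0)
    (h : A.transpose * g * A = t • g') : A * g'⁻¹ * A.transpose = t • g⁻¹ := by
  have hinv : t⁻¹ • g'⁻¹ = A⁻¹ * (g⁻¹ * A.transpose⁻¹) := by
    rw [← Matrix.mul_inv_rev, ← Matrix.mul_inv_rev, h]
    exact (Matrix.inv_smul' g' (Units.mk0 t ht) hg').symm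
  rw [(inv_smul_eq_iff₀ ht).1 hinv, Matrix.mul_smul, Matrix.smul_mul,
    Matrix.mul_nonsing_inv_cancel_left _ _ hA, Matrix.mul_assoc,
    Matrix.nonsing_inv_mul _ (by rwa [Matrix.det_transpose]), Matrix.mul_one]

theorem contDiffOn_det {V ι : Type*} [NormedAddCommGroup V] [NormedSpace ℝ V] [Fintype ι]
    [DecidableEq ι] {A : V → Matrix ι ι ℝ} {U : Set V} {n : WithTop ℕ∞}
    (hA : ∀ i j, ContDiffOn ℝ n (fun x ↦ A x i j) U) : ContDiffOn ℝ n (fun x ↦ (A x).det) U := by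
  simp only [Matrix.det_apply']
  exact ContDiffOn.sum fun σ _ ↦ contDiffOn_const.mul (contDiffOn_prod fun i _ ↦ hA _ _)

theorem contDiffOn_inv_matrix {V ι : Type*} [NormedAddCommGroup V] [NormedSpace ℝ V] [Fintype ι]
    [DecidableEq ι] {A : V → Matrix ι ι ℝ} {U : Set V} {n : WithTop ℕ∞}
    (hA : ∀ i j, ContDiffOn ℝ n (fun x ↦ A x i j) U) (hdet : ∀ x ∈ U, (A x).det ≠ 0) (i j : ι) :
    ContDiffOn ℝ n (fun x ↦ (A x)⁻¹ i j) U := by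
  simp only [Matrix.inv_def, Matrix.smul_apply, smul_eq_mul, Ring.inverse_eq_inv',
    Matrix.adjugate_apply]
  refine ((contDiffOn_det hA).inv hdet).mul (contDiffOn_det fun k l ↦ ?_)
  rcases eq_or_ne k j with rfl | hk
  · simpa only [Matrix.updateRow_self] using contDiffOn_const
  · simpa only [Matrix.updateRow_ne hk] using hA k l

section Gram

variable {E ι : Type*} [NormedAddCommGroup E] [NormedSpace ℝ E] [Fintype ι] [DecidableEq ι]

/-- The Gram matrix of the vectors `e` with respect to the bilinear form `B`. -/
noncomputable def gramMatrix (e : ι → E) (B : E →L[ℝ] E →L[ℝ] ℝ) : Matrix ι ι ℝ :=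
  Matrix.of fun i j ↦ B (e i) (e j)

theorem gramMatrix_eq_toMatrix₂ (e : Module.Basis ι ℝ E) (B : E →L[ℝ] E →L[ℝ] ℝ) :
    gramMatrix e B = LinearMap.toMatrix₂ e e B.toLinearMap₁₂ := by
  ext i j
  simp [gramMatrix, LinearMap.toMatrix₂_apply]

theorem det_gramMatrix_ne_zero (e : Module.Basis ι ℝ E) {B : E →L[ℝ] E →L[ℝ] ℝ}
    (hB : ∀ u, (∀ v, B u v = 0) → u = 0) : (gramMatrix e B).det ≠ 0 := by
  rw [gramMatrix_eq_toMatrix₂, ← LinearMap.separatingLeft_iff_det_ne_zero e]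
  exact hB

theorem IsHomothetyOn.transpose_mul_gramMatrix_mul {τ : E → E} {c : ℝ}
    {G' G : E → E →L[ℝ] E →L[ℝ] ℝ} {U' U : Set E} (hτ : IsHomothetyOn τ c G' U' G U)
    {y : E} (hy : y ∈ U') (e : Module.Basis ι ℝ E) :
    (LinearMap.toMatrix e e (fderiv ℝ τ y)).transpose * gramMatrix e (G (τ y)) *
      LinearMap.toMatrix e e (fderiv ℝ τ y) = c ^ 2 • gramMatrix e (G' y) := by
  rw [gramMatrix_eq_toMatrix₂, ← LinearMap.toMatrix₂_compl₁₂]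
  ext i j
  simp [gramMatrix, LinearMap.toMatrix₂_apply, hτ.pullback y hy]

end Gram

theorem WeylContraction.two_mul_factors_le (c : WeylContraction) : 2 * c.factors ≤ c.pairs := by
  have h := Fintype.card_congr c.pairing
  simp only [Fintype.card_sigma, Fintype.card_fin, Fintype.card_sum, Finset.sum_add_distrib,
    Finset.sum_const, Finset.card_univ, smul_eq_mul] at h
  omega

theorem WeylContraction.pairs_sub_factors_pos (c : WeylContraction) :
    0 < c.pairs - c.factors := by
  have := c.two_mul_factors_le
  have := c.factors_pos
  omega

variable {E : Type*} [NormedAddCommGroup E] [NormedSpace ℝ E] [FiniteDimensional ℝ E]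
  {G' G : E → E →L[ℝ] E →L[ℝ] ℝ} {U' U : Set E}

theorem IsMetricOn.exists_multilinear_prod_nablaCurvature (hG : IsMetricOn G U) {x : E}
    (hx : x ∈ U) (w : WeylContraction) :
    ∃ Φ : MultilinearMap ℝ (fun _ : Fin w.pairs ⊕ Fin w.pairs ↦ E) ℝ, ∀ v,
      Φ v = ∏ i, nablaCurvature G (w.order i) x fun s ↦ v (w.pairing ⟨i, s⟩) := by
  choose S _ hS using hG.isTensorFieldOn_nablaCurvature
  refine ⟨((MultilinearMap.mkPiAlgebra ℝ (Fin w.factors) ℝ).compMultilinearMap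
    fun i ↦ (S (w.order i) x).toMultilinearMap).domDomCongr w.pairing, fun v ↦ ?_⟩
  simp only [← hS _ x hx]
  rfl

theorem WeylContraction.coordValue_eq_contractPairs (w : WeylContraction) {x : E}
    {Φ : MultilinearMap ℝ (fun _ : Fin w.pairs ⊕ Fin w.pairs ↦ E) ℝ}
    (hΦ : ∀ v, Φ v = ∏ i, nablaCurvature G (w.order i) x fun s ↦ v (w.pairing ⟨i, s⟩)) :
    w.coordValue G x =
      contractPairs (gramMatrix (Module.finBasis ℝ E) (G x))⁻¹ Φ (Module.finBasis ℝ E) := by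
  simp only [contractPairs, hΦ]
  rfl

theorem IsHomothetyOn.coordValue_eq {τ : E → E} {c : ℝ} (hτ : IsHomothetyOn τ c G' U' G U)
    (hG' : IsMetricOn G' U') (hG : IsMetricOn G U) (w : WeylContraction) {y : E} (hy : y ∈ U') :
    w.coordValue G' y = (c ^ 2) ^ (w.pairs - w.factors) * w.coordValue G (τ y) := by
  have hc : c ^ 2 ≠ 0 := pow_ne_zero 2 hτ.ne_zero
  obtain ⟨Φ, hΦ⟩ := hG.exists_multilinear_prod_nablaCurvature (hτ.mapsTo hy) w
  have hΦ' (v) : ((c ^ 2)⁻¹ ^ w.factors • Φ.compLinearMap fun _ ↦ (fderiv ℝ τ y : E →ₗ[ℝ] E)) v =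
      ∏ i, nablaCurvature G' (w.order i) y fun s ↦ v (w.pairing ⟨i, s⟩) := by
    simp [hτ.nablaCurvature_eq hG' hG _ hy, Finset.prod_mul_distrib, hΦ]
  have hdet : IsUnit (LinearMap.toMatrix (Module.finBasis ℝ E) (Module.finBasis ℝ E)
      (fderiv ℝ τ y : E →ₗ[ℝ] E)).det := by
    rw [LinearMap.det_toMatrix]
    exact LinearMap.isUnit_det _ ((Module.End.isUnit_iff _).2 (hτ.bijective_fderiv hG' hy))
  have hinv := mul_inv_mul_transpose_of_congruence hdet
    (det_gramMatrix_ne_zero _ (hG'.nondegenerate y hy)).isUnit hc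
    (hτ.transpose_mul_gramMatrix_mul hy _)
  have hle : w.factors ≤ w.pairs := by have := w.two_mul_factors_le; omega
  rw [w.coordValue_eq_contractPairs hΦ', w.coordValue_eq_contractPairs hΦ, contractPairs_smul_right,
    contractPairs_compLinearMap, hinv, contractPairs_smul, Fintype.card_fin, pow_sub₀ _ hc hle,
    inv_pow]
  ring

theorem IsMetricOn.contDiffOn_coordValue (hG : IsMetricOn G U) (w : WeylContraction) :
    ContDiffOn ℝ ∞ (w.coordValue G) U := by
  set e := Module.finBasis ℝ E
  have hinv := contDiffOn_inv_matrix (A := fun x ↦ gramMatrix e (G x))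
    (fun i j ↦ (hG.contDiffOn.clm_apply contDiffOn_const).clm_apply contDiffOn_const)
    fun x hx ↦ det_gramMatrix_ne_zero e (hG.nondegenerate x hx)
  unfold WeylContraction.coordValue
  exact ContDiffOn.sum fun a _ ↦ ContDiffOn.sum fun b _ ↦
    (contDiffOn_prod fun j _ ↦ hinv _ _).mul (contDiffOn_prod fun i _ ↦
      (hG.isTensorFieldOn_nablaCurvature (w.order i)).contDiffOn_apply _)

end Contraction

section Charts

variable {E : Type*} [NormedAddCommGroup E] [NormedSpace ℝ E]
  {M : Type*} [TopologicalSpace M] [ChartedSpace E M]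

section CoordinateExpression

/-- The expression of a map `T : M → M` in the preferred charts at `p` and `q`, to be used on
`coordDomain T p q` only. -/
noncomputable def coordExpr (T : M → M) (p q : M) (x : E) : E :=
  extChartAt 𝓘(ℝ, E) q (T ((extChartAt 𝓘(ℝ, E) p).symm x))

/-- The natural domain of `coordExpr T p q`. -/
def coordDomain (T : M → M) (p q : M) : Set E :=
  (extChartAt 𝓘(ℝ, E) p).target ∩
    (fun x ↦ T ((extChartAt 𝓘(ℝ, E) p).symm x)) ⁻¹' (extChartAt 𝓘(ℝ, E) q).source

variable {T : M → M} {p q : M}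

theorem mapsTo_coordExpr :
    Set.MapsTo (coordExpr T p q) (coordDomain T p q) (extChartAt 𝓘(ℝ, E) q).target :=
  fun _ hx ↦ (extChartAt 𝓘(ℝ, E) q).map_source hx.2

theorem extChartAt_mem_coordDomain (hq : T p ∈ (extChartAt 𝓘(ℝ, E) q).source) :
    extChartAt 𝓘(ℝ, E) p p ∈ coordDomain (E := E) T p q :=
  ⟨mem_extChartAt_target p, by simpa only [Set.mem_preimage, extChartAt_to_inv] using hq⟩

theorem coordExpr_extChartAt_self :
    coordExpr T p q (extChartAt 𝓘(ℝ, E) p p) = extChartAt 𝓘(ℝ, E) q (T p) := by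
  rw [coordExpr, extChartAt_to_inv]

theorem isOpen_coordDomain (hT : Continuous T) : IsOpen (coordDomain (E := E) T p q) :=
  (hT.comp_continuousOn (continuousOn_extChartAt_symm p)).isOpen_inter_preimage
    (isOpen_extChartAt_target p) (isOpen_extChartAt_source q)

variable [IsManifold 𝓘(ℝ, E) ∞ M]

theorem contDiffOn_coordExpr (hT : ContMDiff 𝓘(ℝ, E) 𝓘(ℝ, E) ∞ T) :
    ContDiffOn ℝ ∞ (coordExpr T p q) (coordDomain (E := E) T p q) := by
  have hTφ : ContMDiffOn 𝓘(ℝ, E) 𝓘(ℝ, E) ∞ (fun x ↦ T ((extChartAt 𝓘(ℝ, E) p).symm x))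
      (extChartAt 𝓘(ℝ, E) p).target := hT.comp_contMDiffOn (contMDiffOn_extChartAt_symm p)
  have hφ : ContMDiffOn 𝓘(ℝ, E) 𝓘(ℝ, E) ∞ (extChartAt 𝓘(ℝ, E) q)
      (extChartAt 𝓘(ℝ, E) q).source := by
    simpa only [extChartAt_source] using contMDiffOn_extChartAt
  exact contMDiffOn_iff_contDiffOn.1
    (hφ.comp (hTφ.mono Set.inter_subset_left) fun x hx ↦ hx.2)

theorem contMDiffAt_extChartAt_symm {x : E} (hx : x ∈ (extChartAt 𝓘(ℝ, E) p).target) :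
    ContMDiffAt 𝓘(ℝ, E) 𝓘(ℝ, E) ∞ (extChartAt 𝓘(ℝ, E) p).symm x :=
  (contMDiffOn_extChartAt_symm p x hx).contMDiffAt ((isOpen_extChartAt_target p).mem_nhds hx)

theorem isInvertible_mfderiv_extChartAt_symm {x : E}
    (hx : x ∈ (extChartAt 𝓘(ℝ, E) p).target) :
    (mfderiv 𝓘(ℝ, E) 𝓘(ℝ, E) (extChartAt 𝓘(ℝ, E) p).symm x).IsInvertible := by
  have : IsManifold 𝓘(ℝ, E) 1 M := .of_le (n := ∞) ENat.LEInfty.out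
  simpa only [modelWithCornersSelf_coe, Set.range_id, mfderivWithin_univ]
    using isInvertible_mfderivWithin_extChartAt_symm (I := 𝓘(ℝ, E)) hx

theorem mfderiv_extChartAt_symm_fderiv_coordExpr (hT : ContMDiff 𝓘(ℝ, E) 𝓘(ℝ, E) ∞ T) {y : E}
    (hy : y ∈ coordDomain T p q) (v : E) :
    mfderiv 𝓘(ℝ, E) 𝓘(ℝ, E) (extChartAt 𝓘(ℝ, E) q).symm (coordExpr T p q y)
        (fderiv ℝ (coordExpr T p q) y v) =
      (mfderiv 𝓘(ℝ, E) 𝓘(ℝ, E) T ((extChartAt 𝓘(ℝ, E) p).symm y)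
        (mfderiv 𝓘(ℝ, E) 𝓘(ℝ, E) (extChartAt 𝓘(ℝ, E) p).symm y v) : E) := by
  have hU := (isOpen_coordDomain hT.continuous).mem_nhds hy
  have hτ : MDifferentiableAt 𝓘(ℝ, E) 𝓘(ℝ, E) (coordExpr T p q) y :=
    (differentiableAt_of_contDiffOn (contDiffOn_coordExpr hT)
      (isOpen_coordDomain hT.continuous) hy).mdifferentiableAt
  have hcomp : (extChartAt 𝓘(ℝ, E) q).symm ∘ coordExpr T p q =ᶠ[nhds y]
      T ∘ (extChartAt 𝓘(ℝ, E) p).symm :=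
    Filter.eventuallyEq_of_mem hU fun x hx ↦ (extChartAt 𝓘(ℝ, E) q).left_inv hx.2
  have hleft := mfderiv_comp y
    ((contMDiffAt_extChartAt_symm (mapsTo_coordExpr hy)).mdifferentiableAt (by simp)) hτ
  have hright := mfderiv_comp y ((hT _).mdifferentiableAt (by simp))
    ((contMDiffAt_extChartAt_symm hy.1).mdifferentiableAt (by simp))
  rw [mfderiv_eq_fderiv] at hleft
  exact (DFunLike.congr_fun hleft v).symm.trans
    ((DFunLike.congr_fun hcomp.mfderiv_eq v).trans (DFunLike.congr_fun hright v))

end CoordinateExpression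

variable [IsManifold 𝓘(ℝ, E) ∞ M]

theorem contMDiffOn_tangent_extChartAt_symm (p : M) (u : E) :
    ContMDiffOn 𝓘(ℝ, E) 𝓘(ℝ, E).tangent ∞
      (fun x : E ↦ (⟨(extChartAt 𝓘(ℝ, E) p).symm x,
        mfderiv 𝓘(ℝ, E) 𝓘(ℝ, E) (extChartAt 𝓘(ℝ, E) p).symm x u⟩ : TangentBundle 𝓘(ℝ, E) M))
      (extChartAt 𝓘(ℝ, E) p).target := by
  have : IsManifold 𝓘(ℝ, E) 1 M := .of_le (n := ∞) ENat.LEInfty.out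
  have hopen := isOpen_extChartAt_target (I := 𝓘(ℝ, E)) p
  have htangent := (contMDiffOn_extChartAt_symm (I := 𝓘(ℝ, E)) (n := ∞)
    p).contMDiffOn_tangentMapWithin (m := ∞) le_rfl hopen.uniqueMDiffOn
  have hu : ContMDiffOn 𝓘(ℝ, E) 𝓘(ℝ, E).tangent ∞
      (fun x : E ↦ (⟨x, u⟩ : TangentBundle 𝓘(ℝ, E) E)) (extChartAt 𝓘(ℝ, E) p).target :=
    contMDiffOn_vectorSpace_iff_contDiffOn.2 contDiffOn_const
  refine (htangent.comp hu fun x hx ↦ hx).congr fun x hx ↦ ?_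
  simp only [tangentMapWithin, Function.comp_apply, mfderivWithin_of_isOpen hopen hx]

namespace PseudoRiemannianMetric

theorem ext_inner {g₁ g₂ : PseudoRiemannianMetric E M} (h : ∀ p, g₁.inner p = g₂.inner p) :
    g₁ = g₂ := by
  cases g₁
  cases g₂
  congr
  exact funext h

/-- The product of a metric and a smooth function without zeros. -/
noncomputable def rescale (g : PseudoRiemannianMetric E M) (f : M → ℝ)
    (hf : ContMDiff 𝓘(ℝ, E) 𝓘(ℝ, ℝ) ∞ f) (hf0 : ∀ p, f p ≠ 0) : PseudoRiemannianMetric E M where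
  inner p := f p • g.inner p
  symm p v w := congrArg (f p * ·) (g.symm p v w)
  nondegenerate p v hv :=
    g.nondegenerate p v fun w ↦ (mul_eq_zero.1 (hv w)).resolve_left (hf0 p)
  contMDiff := hf.smul_section g.contMDiff

theorem pullbackEqSq_id (g : PseudoRiemannianMetric E M) : g.PullbackEqSq id 1 := by
  intro p v w
  simp [mfderiv_id]

/-- The metric at a point, viewed as a bilinear form on the model space: identities between tangent
vectors at base points that are only propositionally equal can be rewritten in it. -/
noncomputable def modelInner (g : PseudoRiemannianMetric E M) (p : M) : E →L[ℝ] E →L[ℝ] ℝ :=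
  g.inner p

theorem inChart_apply (g : PseudoRiemannianMetric E M) (p : M) (x u v : E) :
    g.inChart p x u v = g.modelInner ((extChartAt 𝓘(ℝ, E) p).symm x)
      (mfderiv 𝓘(ℝ, E) 𝓘(ℝ, E) (extChartAt 𝓘(ℝ, E) p).symm x u)
      (mfderiv 𝓘(ℝ, E) 𝓘(ℝ, E) (extChartAt 𝓘(ℝ, E) p).symm x v) := rfl

theorem contDiffOn_inChart_apply (g : PseudoRiemannianMetric E M) (p : M) (u v : E) :
    ContDiffOn ℝ ∞ (fun x ↦ g.inChart p x u v) (extChartAt 𝓘(ℝ, E) p).target := by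
  rw [← contMDiffOn_iff_contDiffOn]
  intro x hx
  have hg : ContMDiffWithinAt 𝓘(ℝ, E) (𝓘(ℝ, E).prod 𝓘(ℝ, E →L[ℝ] E →L[ℝ] ℝ)) ∞
      (fun y ↦ Bundle.TotalSpace.mk' (E →L[ℝ] E →L[ℝ] ℝ)
        (E := fun p : M ↦ TangentSpace 𝓘(ℝ, E) p →L[ℝ] TangentSpace 𝓘(ℝ, E) p →L[ℝ]
          Bundle.Trivial M ℝ p)
        ((extChartAt 𝓘(ℝ, E) p).symm y) (g.inner ((extChartAt 𝓘(ℝ, E) p).symm y)))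
      (extChartAt 𝓘(ℝ, E) p).target x :=
    (g.contMDiff _).comp_contMDiffWithinAt x (contMDiffOn_extChartAt_symm p x hx)
  have happly := ContMDiffWithinAt.clm_bundle_apply₂ (F₁ := E) (F₂ := E) (F₃ := ℝ)
    (E₁ := fun p : M ↦ TangentSpace 𝓘(ℝ, E) p) (E₂ := fun p : M ↦ TangentSpace 𝓘(ℝ, E) p)
    (E₃ := Bundle.Trivial M ℝ) hg
    (contMDiffOn_tangent_extChartAt_symm p u x hx)
    (contMDiffOn_tangent_extChartAt_symm p v x hx)
  rw [Bundle.contMDiffWithinAt_totalSpace] at happly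
  exact happly.2

theorem PullbackEqSq.isHomothetyOn {g : PseudoRiemannianMetric E M} {T : M → M} {c : ℝ}
    (h : g.PullbackEqSq T c) (hT : ContMDiff 𝓘(ℝ, E) 𝓘(ℝ, E) ∞ T) (hc : c ≠ 0) (p q : M) :
    IsHomothetyOn (coordExpr T p q) c (g.inChart p) (coordDomain T p q) (g.inChart q)
      (extChartAt 𝓘(ℝ, E) q).target where
  contDiffOn := contDiffOn_coordExpr hT
  mapsTo := mapsTo_coordExpr
  ne_zero := hc
  pullback y hy u v := by
    have hbase : (extChartAt 𝓘(ℝ, E) q).symm (coordExpr T p q y) =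
        T ((extChartAt 𝓘(ℝ, E) p).symm y) := (extChartAt 𝓘(ℝ, E) q).left_inv hy.2
    rw [inChart_apply, inChart_apply]
    refine Eq.trans ?_ (h _ (mfderiv 𝓘(ℝ, E) 𝓘(ℝ, E) (extChartAt 𝓘(ℝ, E) p).symm y u)
      (mfderiv 𝓘(ℝ, E) 𝓘(ℝ, E) (extChartAt 𝓘(ℝ, E) p).symm y v))
    rw [mfderiv_extChartAt_symm_fderiv_coordExpr hT hy u,
      mfderiv_extChartAt_symm_fderiv_coordExpr hT hy v, hbase]
    rfl

variable [FiniteDimensional ℝ E]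

theorem isMetricOn_inChart (g : PseudoRiemannianMetric E M) (p : M) :
    IsMetricOn (g.inChart p) (extChartAt 𝓘(ℝ, E) p).target where
  isOpen := isOpen_extChartAt_target p
  contDiffOn := by
    simp only [contDiffOn_clm_apply]
    exact fun u v ↦ g.contDiffOn_inChart_apply p u v
  symm x _ u v := by
    rw [inChart_apply, inChart_apply]
    exact g.symm _ _ _
  nondegenerate x hx u hu := by
    obtain ⟨e, he⟩ : ∃ e : E ≃L[ℝ] E, (e : E →L[ℝ] E) =
        mfderiv 𝓘(ℝ, E) 𝓘(ℝ, E) (extChartAt 𝓘(ℝ, E) p).symm x :=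
      isInvertible_mfderiv_extChartAt_symm hx
    have heu : e u = 0 := by
      refine g.nondegenerate ((extChartAt 𝓘(ℝ, E) p).symm x) (e u) fun w ↦ ?_
      have hw := hu (e.symm w)
      rw [inChart_apply, ← he] at hw
      exact (congrArg (g.modelInner _ (e u)) (e.apply_symm_apply w)).symm.trans hw
    exact e.map_eq_zero_iff.1 heu

theorem PullbackEqSq.weylScalar_eq_coordValue {g : PseudoRiemannianMetric E M} {T : M → M} {c : ℝ}
    (h : g.PullbackEqSq T c) (hT : ContMDiff 𝓘(ℝ, E) 𝓘(ℝ, E) ∞ T) (hc : c ≠ 0)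
    (w : WeylContraction) {p q : M} (hq : T p ∈ (extChartAt 𝓘(ℝ, E) q).source) :
    g.weylScalar w p = (c ^ 2) ^ (w.pairs - w.factors) *
      w.coordValue (g.inChart q) (extChartAt 𝓘(ℝ, E) q (T p)) := by
  have hU := isOpen_coordDomain (E := E) (p := p) (q := q) hT.continuous
  rw [weylScalar, (h.isHomothetyOn hT hc p q).coordValue_eq
    ((g.isMetricOn_inChart p).mono hU Set.inter_subset_left) (g.isMetricOn_inChart q) w
    (extChartAt_mem_coordDomain hq), coordExpr_extChartAt_self]

theorem PullbackEqSq.weylScalar_eq {g : PseudoRiemannianMetric E M} {T : M → M} {c : ℝ}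
    (h : g.PullbackEqSq T c) (hT : ContMDiff 𝓘(ℝ, E) 𝓘(ℝ, E) ∞ T) (hc : c ≠ 0)
    (w : WeylContraction) (p : M) :
    g.weylScalar w p = (c ^ 2) ^ (w.pairs - w.factors) * g.weylScalar w (T p) :=
  h.weylScalar_eq_coordValue hT hc w (mem_extChartAt_source (T p))

/- Applied to the identity, `weylScalar_eq_coordValue` says that the chart in which a Weyl scalar is
computed does not matter. -/
theorem contMDiff_weylScalar (g : PseudoRiemannianMetric E M) (w : WeylContraction) :
    ContMDiff 𝓘(ℝ, E) 𝓘(ℝ, ℝ) ∞ (g.weylScalar w) := by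
  intro q
  have hcoord : ContMDiffAt 𝓘(ℝ, E) 𝓘(ℝ, ℝ) ∞
      (fun p ↦ w.coordValue (g.inChart q) (extChartAt 𝓘(ℝ, E) q p)) q :=
    (((g.isMetricOn_inChart q).contDiffOn_coordValue w).contDiffAt
      ((isOpen_extChartAt_target q).mem_nhds (mem_extChartAt_target q))).contMDiffAt.comp q
        contMDiffAt_extChartAt
  refine hcoord.congr_of_eventuallyEq
    (Filter.eventuallyEq_of_mem (extChartAt_source_mem_nhds (I := 𝓘(ℝ, E)) q) fun p hp ↦ ?_)
  simpa using g.pullbackEqSq_id.weylScalar_eq_coordValue contMDiff_id one_ne_zero w (p := p) hp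

end PseudoRiemannianMetric

end Charts

section ConstantRank

variable {E : Type*} [NormedAddCommGroup E] [NormedSpace ℝ E]
  {F : Type*} [NormedAddCommGroup F] [NormedSpace ℝ F]
  {G : Type*} [NormedAddCommGroup G] [NormedSpace ℝ G]

theorem eventually_differentiableAt {n : WithTop ℕ∞} (hn : n ≠ 0) {f : F → E} {x : F}
    (hf : ContDiffAt ℝ n f x) : ∀ᶠ y in nhds x, DifferentiableAt ℝ f y :=
  ((hf.of_le (ENat.one_le_iff_ne_zero_withTop.2 hn)).eventually (by simp)).mono
    fun _ h ↦ h.differentiableAt one_ne_zero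

variable [CompleteSpace F] [FiniteDimensional ℝ G]

theorem exists_submersion_chart {n : WithTop ℕ∞} (hn : n ≠ 0) {φ : F → G} {x₀ : F}
    (hφ : ContDiffAt ℝ n φ x₀) (hsurj : Function.Surjective (fderiv ℝ φ x₀)) :
    ∃ e : OpenPartialHomeomorph F (G × (fderiv ℝ φ x₀).ker), x₀ ∈ e.source ∧
      (∀ x, (e x).1 = φ x) ∧ ContDiffAt ℝ n e.symm (e x₀) := by
  have : CompleteSpace G := FiniteDimensional.complete ℝ G
  have hstrict := hφ.hasStrictFDerivAt hn
  have hrange : (fderiv ℝ φ x₀).range = ⊤ := LinearMap.range_eq_top.2 hsurj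
  have hker := (fderiv ℝ φ x₀).ker_closedComplemented_of_finiteDimensional_range
  exact ⟨hstrict.implicitToOpenPartialHomeomorph φ _ hrange,
    hstrict.mem_implicitToOpenPartialHomeomorph_source hrange, fun _ ↦ rfl,
    ImplicitFunctionData.contDiffAt_implicitFunction
      (φ := hstrict.implicitFunctionDataOfComplemented φ _ hrange hker) hφ
      (hker.choose.contDiff.contDiffAt.comp x₀ (contDiffAt_id.sub contDiffAt_const)) hn⟩

theorem exists_contDiffAt_section {n : WithTop ℕ∞} (hn : n ≠ 0) {φ : F → G} {x₀ : F}
    (hφ : ContDiffAt ℝ n φ x₀) (hsurj : Function.Surjective (fderiv ℝ φ x₀)) :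
    ∃ s : G → F, ContDiffAt ℝ n s (φ x₀) ∧ s (φ x₀) = x₀ ∧ ∀ᶠ y in nhds (φ x₀), φ (s y) = y := by
  obtain ⟨e, hx₀, hfst, hsymm⟩ := exists_submersion_chart hn hφ hsurj
  let ι : G → G × (fderiv ℝ φ x₀).ker := fun y ↦ (y, (e x₀).2)
  have hι : ContDiffAt ℝ n ι (φ x₀) := contDiffAt_id.prodMk contDiffAt_const
  have hιx₀ : ι (φ x₀) = e x₀ := Prod.ext (hfst x₀).symm rfl
  refine ⟨e.symm ∘ ι, (hιx₀ ▸ hsymm).comp (φ x₀) hι, ?_, ?_⟩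
  · rw [Function.comp_apply, hιx₀, e.left_inv hx₀]
  · have htarget : ∀ᶠ y in nhds (φ x₀), ι y ∈ e.target :=
      hι.continuousAt.eventually_mem (hιx₀ ▸ e.open_target.mem_nhds (e.map_source hx₀))
    filter_upwards [htarget] with y hy
    rw [Function.comp_apply, ← hfst, e.right_inv hy]

theorem eventually_eq_mk_snd_of_fderiv_eq_zero {A B : Type*} [NormedAddCommGroup A]
    [NormedSpace ℝ A] [NormedAddCommGroup B] [NormedSpace ℝ B] {f : A × B → E} {p : A × B}
    (hf : ∀ᶠ q in nhds p, DifferentiableAt ℝ f q ∧ ∀ b, fderiv ℝ f q (0, b) = 0) :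
    ∀ᶠ q in nhds p, f q = f (q.1, p.2) := by
  obtain ⟨ε, hε, hball⟩ := Metric.eventually_nhds_iff_ball.1 hf
  rw [← Prod.mk.eta (p := p), ← ball_prod_same] at hball
  rw [← Prod.mk.eta (p := p), nhds_prod_eq]
  filter_upwards [Filter.prod_mem_prod (Metric.ball_mem_nhds p.1 hε) (Metric.ball_mem_nhds p.2 hε)]
  rintro ⟨a, b⟩ ⟨ha, hb⟩
  have hslice : ∀ b' ∈ Metric.ball p.2 ε, HasFDerivAt (fun b ↦ f (a, b)) (0 : B →L[ℝ] E) b' := by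
    intro b' hb'
    obtain ⟨hdiff, hzero⟩ := hball (a, b') ⟨ha, hb'⟩
    refine (hdiff.hasFDerivAt.comp b' (hasFDerivAt_prodMk_right a b')).congr_fderiv ?_
    ext v
    exact hzero v
  exact (convex_ball p.2 ε).is_const_of_fderivWithin_eq_zero (𝕜 := ℝ)
    (fun b' hb' ↦ (hslice b' hb').differentiableAt.differentiableWithinAt)
    (fun b' hb' ↦ (fderivWithin_of_isOpen Metric.isOpen_ball hb').trans (hslice b' hb').fderiv)
    hb (Metric.mem_ball_self hε)

theorem exists_eventuallyEq_comp_of_ker_fderiv_le {n : WithTop ℕ∞} (hn : n ≠ 0) {φ : F → G}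
    {ψ : F → E} {x₀ : F} (hφ : ContDiffAt ℝ n φ x₀) (hψ : ContDiffAt ℝ n ψ x₀)
    (hsurj : Function.Surjective (fderiv ℝ φ x₀))
    (hker : ∀ᶠ x in nhds x₀, (fderiv ℝ φ x).ker ≤ (fderiv ℝ ψ x).ker) :
    ∃ σ : G → E, ContDiffAt ℝ n σ (φ x₀) ∧ ψ =ᶠ[nhds x₀] σ ∘ φ := by
  obtain ⟨e, hx₀, hfst, hsymm⟩ := exists_submersion_chart hn hφ hsurj
  have hsymm_tendsto : Filter.Tendsto e.symm (nhds (e x₀)) (nhds x₀) := e.tendsto_symm hx₀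
  have hvertical : ∀ᶠ q in nhds (e x₀), DifferentiableAt ℝ (ψ ∘ e.symm) q ∧
      ∀ k, fderiv ℝ (ψ ∘ e.symm) q (0, k) = 0 := by
    filter_upwards [eventually_differentiableAt hn hsymm,
      hsymm_tendsto.eventually (eventually_differentiableAt hn hφ),
      hsymm_tendsto.eventually (eventually_differentiableAt hn hψ), hsymm_tendsto.eventually hker,
      e.open_target.mem_nhds (e.map_source hx₀)] with q hsymm_q hφq hψq hker_q hq
    refine ⟨hψq.comp q hsymm_q, fun k ↦ ?_⟩
    have hfst_q : φ ∘ e.symm =ᶠ[nhds q] Prod.fst := by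
      filter_upwards [e.open_target.mem_nhds hq] with q' hq'
      rw [Function.comp_apply, ← hfst, e.right_inv hq']
    have hφ_vertical : fderiv ℝ φ (e.symm q) (fderiv ℝ e.symm q (0, k)) = 0 := by
      have h := hfst_q.fderiv_eq (𝕜 := ℝ)
      rw [fderiv_comp q hφq hsymm_q, fderiv_fst] at h
      exact DFunLike.congr_fun h (0, k)
    rw [fderiv_comp q hψq hsymm_q]
    exact hker_q hφ_vertical
  have hψe : ContDiffAt ℝ n (ψ ∘ e.symm) (e x₀) := ((e.left_inv hx₀).symm ▸ hψ).comp _ hsymm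
  let ι : G → G × (fderiv ℝ φ x₀).ker := fun y ↦ (y, (e x₀).2)
  have hι : ContDiffAt ℝ n ι (φ x₀) := contDiffAt_id.prodMk contDiffAt_const
  have hιx₀ : ι (φ x₀) = e x₀ := Prod.ext (hfst x₀).symm rfl
  refine ⟨(ψ ∘ e.symm) ∘ ι, (hιx₀ ▸ hψe).comp (φ x₀) hι, ?_⟩
  filter_upwards [(e.continuousAt hx₀).eventually
    (eventually_eq_mk_snd_of_fderiv_eq_zero hvertical), e.open_source.mem_nhds hx₀] with x hx hxs
  rwa [Function.comp_apply, e.left_inv hxs, hfst] at hx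

theorem not_nhds_le_map_of_finrank_lt [FiniteDimensional ℝ E] {σ : G → E} {y : G}
    (hσ : ContDiffAt ℝ 1 σ y) (hdim : Module.finrank ℝ G < Module.finrank ℝ E) :
    ¬ nhds (σ y) ≤ Filter.map σ (nhds y) := by
  intro hopen
  obtain ⟨u, hu, hσu⟩ := hσ.contDiffOn le_rfl (by simp)
  obtain ⟨ε, hε, hball⟩ := Metric.mem_nhds_iff.1 hu
  have hdense : Dense (σ '' Metric.ball y ε)ᶜ := by
    refine (hσu.mono hball).dense_compl_image_of_dimH_lt_finrank (convex_ball y ε) subset_rfl ?_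
    rw [Real.dimH_of_mem_nhds (Metric.ball_mem_nhds y hε)]
    exact_mod_cast hdim
  obtain ⟨z, hz, hz'⟩ := mem_closure_iff_nhds.1 (hdense (σ y)) _
    (hopen (Filter.image_mem_map (Metric.ball_mem_nhds y hε)))
  exact hz' hz

theorem eventually_surjective {A : E →L[ℝ] G} (hA : Function.Surjective A) :
    ∀ᶠ B : E →L[ℝ] G in nhds A, Function.Surjective B := by
  have hrank (B : E →L[ℝ] G) : Module.finrank ℝ G ≤ (B : E →ₗ[ℝ] G).rank ↔
      Function.Surjective B := by
    rw [LinearMap.rank, ← Module.finrank_eq_rank, Nat.cast_le]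
    refine ⟨fun h ↦ ?_, fun h ↦ ?_⟩
    · exact LinearMap.range_eq_top.1
        (Submodule.eq_top_of_finrank_eq ((Submodule.finrank_le _).antisymm h))
    · rw [LinearMap.range_eq_top.2 h, finrank_top]
  filter_upwards [(isOpen_setOfPred_nat_le_rank (Module.finrank ℝ G)).mem_nhds ((hrank A).2 hA)]
    with B hB using (hrank B).1 hB

/-- The constant rank theorem and Sard's theorem in the easy case of a source of smaller dimension:
with `P` a projection onto the range `R` of the derivative at `x₀`, `ψ` factors near `x₀` through
the submersion `P ∘ ψ`, hence through a map `R → E`. -/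
theorem surjective_fderiv_of_rank_le_of_nhds_le_map [FiniteDimensional ℝ E] {ψ : F → E} {x₀ : F}
    (hψ : ContDiffAt ℝ 1 ψ x₀)
    (hrank : ∀ᶠ x in nhds x₀, Module.finrank ℝ (fderiv ℝ ψ x).range ≤
      Module.finrank ℝ (fderiv ℝ ψ x₀).range)
    (hopen : nhds (ψ x₀) ≤ Filter.map ψ (nhds x₀)) :
    Function.Surjective (fderiv ℝ ψ x₀) := by
  by_contra hns
  set R := (fderiv ℝ ψ x₀).range
  have hdim : Module.finrank ℝ R < Module.finrank ℝ E :=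
    Submodule.finrank_lt fun h ↦ hns (LinearMap.range_eq_top.1 h)
  obtain ⟨P, hP⟩ := Submodule.ClosedComplemented.of_finiteDimensional_quotient
    (p := R) R.closed_of_finiteDimensional
  have hφ : ContDiffAt ℝ 1 (P ∘ ψ) x₀ := P.contDiff.contDiffAt.comp x₀ hψ
  have hdiff : ∀ᶠ x in nhds x₀, fderiv ℝ (P ∘ ψ) x = P ∘L fderiv ℝ ψ x :=
    (hψ.eventually (by simp)).mono fun x hx ↦
      (P.hasFDerivAt.comp x (hx.differentiableAt one_ne_zero).hasFDerivAt).fderiv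
  have hsurj : Function.Surjective (fderiv ℝ (P ∘ ψ) x₀) := by
    rintro ⟨_, z, rfl⟩
    rw [hdiff.self_of_nhds]
    exact ⟨z, hP ⟨_, z, rfl⟩⟩
  have hker : ∀ᶠ x in nhds x₀, (fderiv ℝ (P ∘ ψ) x).ker ≤ (fderiv ℝ ψ x).ker := by
    filter_upwards [hrank, hdiff, (hφ.continuousAt_fderiv one_ne_zero).eventually
      (eventually_surjective hsurj)] with x hrank_x hdiff_x hsurj_x
    rw [hdiff_x] at hsurj_x ⊢
    have hmap : (fderiv ℝ ψ x).range.map (P : E →ₗ[ℝ] R) = ⊤ := by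
      rw [← LinearMap.range_comp, ← ContinuousLinearMap.toLinearMap_comp]
      exact LinearMap.range_eq_top.2 hsurj_x
    have hdisj := Submodule.disjoint_ker_of_finrank_le (L := (fderiv ℝ ψ x).range)
      (P : E →ₗ[ℝ] R) (by rwa [hmap, finrank_top])
    exact fun v hv ↦ Submodule.disjoint_def.1 hdisj _ ⟨v, rfl⟩ hv
  obtain ⟨σ, hσ, hψσ⟩ := exists_eventuallyEq_comp_of_ker_fderiv_le one_ne_zero hφ hψ hsurj hker
  refine not_nhds_le_map_of_finrank_lt hσ hdim ?_
  rw [← Function.comp_apply (f := σ), ← hψσ.self_of_nhds]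
  calc nhds (ψ x₀) ≤ Filter.map (σ ∘ P ∘ ψ) (nhds x₀) := hopen.trans (Filter.map_congr hψσ).le
    _ = Filter.map σ (Filter.map (P ∘ ψ) (nhds x₀)) := Filter.map_map.symm
    _ ≤ Filter.map σ (nhds ((P ∘ ψ) x₀)) := Filter.map_mono hφ.continuousAt

end ConstantRank

section Submersion

variable {E : Type*} [NormedAddCommGroup E] [NormedSpace ℝ E]
  {M : Type*} [TopologicalSpace M] [ChartedSpace E M]
  {F : Type*} [NormedAddCommGroup F] [NormedSpace ℝ F]
  {N : Type*} [TopologicalSpace N] [ChartedSpace F N]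
  {f : N → M} {x₀ : N}

theorem contDiffAt_writtenInExtChartAt {n : WithTop ℕ∞} (hf : ContMDiffAt 𝓘(ℝ, F) 𝓘(ℝ, E) n f x₀) :
    ContDiffAt ℝ n (writtenInExtChartAt 𝓘(ℝ, F) 𝓘(ℝ, E) x₀ f) (extChartAt 𝓘(ℝ, F) x₀ x₀) := by
  simpa only [modelWithCornersSelf_coe, Set.range_id, contDiffWithinAt_univ]
    using! (contMDiffAt_iff.1 hf).2

theorem writtenInExtChartAt_extChartAt_self :
    writtenInExtChartAt 𝓘(ℝ, F) 𝓘(ℝ, E) x₀ f (extChartAt 𝓘(ℝ, F) x₀ x₀) =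
      extChartAt 𝓘(ℝ, E) (f x₀) (f x₀) := by
  simp only [writtenInExtChartAt, Function.comp_apply, extChartAt_to_inv]

theorem tendsto_extChartAt_symm_self :
    Filter.Tendsto (extChartAt 𝓘(ℝ, F) x₀).symm (nhds (extChartAt 𝓘(ℝ, F) x₀ x₀)) (nhds x₀) := by
  simpa only [ContinuousAt, extChartAt_to_inv] using continuousAt_extChartAt_symm (I := 𝓘(ℝ, F)) x₀

theorem fderiv_writtenInExtChartAt (hf : MDifferentiableAt 𝓘(ℝ, F) 𝓘(ℝ, E) f x₀) :
    fderiv ℝ (writtenInExtChartAt 𝓘(ℝ, F) 𝓘(ℝ, E) x₀ f) (extChartAt 𝓘(ℝ, F) x₀ x₀) =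
      mfderiv 𝓘(ℝ, F) 𝓘(ℝ, E) f x₀ := by
  rw [hf.mfderiv, modelWithCornersSelf_coe, Set.range_id, fderivWithin_univ]

theorem nhds_le_map_writtenInExtChartAt (hopen : nhds (f x₀) ≤ Filter.map f (nhds x₀)) :
    nhds (writtenInExtChartAt 𝓘(ℝ, F) 𝓘(ℝ, E) x₀ f (extChartAt 𝓘(ℝ, F) x₀ x₀)) ≤
      Filter.map (writtenInExtChartAt 𝓘(ℝ, F) 𝓘(ℝ, E) x₀ f)
        (nhds (extChartAt 𝓘(ℝ, F) x₀ x₀)) := by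
  rw [writtenInExtChartAt_extChartAt_self]
  calc nhds (extChartAt 𝓘(ℝ, E) (f x₀) (f x₀))
      = Filter.map (extChartAt 𝓘(ℝ, E) (f x₀)) (nhds (f x₀)) :=
        (map_extChartAt_nhds_of_boundaryless (f x₀)).symm
    _ ≤ Filter.map (extChartAt 𝓘(ℝ, E) (f x₀)) (Filter.map f (nhds x₀)) := Filter.map_mono hopen
    _ = _ := by
        have hsymm : Filter.map (extChartAt 𝓘(ℝ, F) x₀).symm (nhds (extChartAt 𝓘(ℝ, F) x₀ x₀)) =
            nhds x₀ := by
          simpa only [modelWithCornersSelf_coe, Set.range_id, nhdsWithin_univ]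
            using map_extChartAt_symm_nhdsWithin_range (I := 𝓘(ℝ, F)) x₀
        rw [← hsymm, Filter.map_map, Filter.map_map]
        rfl

variable [IsManifold 𝓘(ℝ, F) ∞ N] [FiniteDimensional ℝ E]

theorem exists_contMDiffAt_section [CompleteSpace F] (hf : ContMDiffAt 𝓘(ℝ, F) 𝓘(ℝ, E) ∞ f x₀)
    (hsurj : Function.Surjective (mfderiv 𝓘(ℝ, F) 𝓘(ℝ, E) f x₀)) :
    ∃ s : M → N, ContMDiffAt 𝓘(ℝ, E) 𝓘(ℝ, F) ∞ s (f x₀) ∧ s (f x₀) = x₀ ∧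
      ∀ᶠ q in nhds (f x₀), f (s q) = q := by
  set φ := extChartAt 𝓘(ℝ, E) (f x₀)
  set κ := extChartAt 𝓘(ℝ, F) x₀
  rw [← fderiv_writtenInExtChartAt (hf.mdifferentiableAt (by simp))] at hsurj
  obtain ⟨σ, hσ, hσx₀, hsec⟩ := exists_contDiffAt_section (by simp)
    (contDiffAt_writtenInExtChartAt hf) hsurj
  rw [writtenInExtChartAt_extChartAt_self] at hσ hσx₀ hsec
  have hσφ : ContMDiffAt 𝓘(ℝ, E) 𝓘(ℝ, F) ∞ (σ ∘ φ) (f x₀) :=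
    hσ.contMDiffAt.comp (f x₀) contMDiffAt_extChartAt
  have hσx₀_mem : (σ ∘ φ) (f x₀) ∈ κ.target := by
    rw [Function.comp_apply, hσx₀]
    exact mem_extChartAt_target x₀
  have hs : ContMDiffAt 𝓘(ℝ, E) 𝓘(ℝ, F) ∞ (κ.symm ∘ σ ∘ φ) (f x₀) :=
    (contMDiffAt_extChartAt_symm hσx₀_mem).comp (f x₀) hσφ
  have hsx₀ : (κ.symm ∘ σ ∘ φ) (f x₀) = x₀ := by
    rw [Function.comp_apply, Function.comp_apply, hσx₀, extChartAt_to_inv]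
  refine ⟨κ.symm ∘ σ ∘ φ, hs, hsx₀, ?_⟩
  have hfs : ContinuousAt (f ∘ κ.symm ∘ σ ∘ φ) (f x₀) :=
    ContinuousAt.comp (hsx₀.symm ▸ hf.continuousAt) hs.continuousAt
  filter_upwards [(continuousAt_extChartAt (I := 𝓘(ℝ, E)) (f x₀)).eventually hsec,
    hfs.eventually_mem (by
      rw [Function.comp_apply, hsx₀]
      exact extChartAt_source_mem_nhds (I := 𝓘(ℝ, E)) (f x₀)),
    extChartAt_source_mem_nhds (I := 𝓘(ℝ, E)) (f x₀)] with q hq hfsq hqφ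
  exact φ.injOn hfsq hqφ hq

theorem finrank_range_comp_comp_le {V₁ V₂ V₃ V₄ : Type*} [AddCommGroup V₁] [Module ℝ V₁]
    [AddCommGroup V₂] [Module ℝ V₂] [AddCommGroup V₃] [Module ℝ V₃] [FiniteDimensional ℝ V₃]
    [AddCommGroup V₄] [Module ℝ V₄] (a : V₃ →ₗ[ℝ] V₄) (b : V₂ →ₗ[ℝ] V₃) (c : V₁ →ₗ[ℝ] V₂) :
    Module.finrank ℝ (a ∘ₗ b ∘ₗ c).range ≤ Module.finrank ℝ b.range := by
  rw [LinearMap.range_comp]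
  exact (Submodule.finrank_map_le _ _).trans
    (Submodule.finrank_mono (LinearMap.range_comp_le_range c b))

variable [IsManifold 𝓘(ℝ, E) ∞ M]

theorem eventually_finrank_fderiv_writtenInExtChartAt_le (hf : MDifferentiable 𝓘(ℝ, F) 𝓘(ℝ, E) f) :
    ∀ᶠ x in nhds (extChartAt 𝓘(ℝ, F) x₀ x₀),
      Module.finrank ℝ (fderiv ℝ (writtenInExtChartAt 𝓘(ℝ, F) 𝓘(ℝ, E) x₀ f) x).range ≤
        Module.finrank ℝ
          (mfderiv 𝓘(ℝ, F) 𝓘(ℝ, E) f ((extChartAt 𝓘(ℝ, F) x₀).symm x)).range := by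
  filter_upwards [extChartAt_target_mem_nhds (I := 𝓘(ℝ, F)) x₀,
    ((hf.continuous.tendsto x₀).comp tendsto_extChartAt_symm_self).eventually_mem
      (extChartAt_source_mem_nhds (I := 𝓘(ℝ, E)) (f x₀))] with x hx hfx
  have hκ := (contMDiffAt_extChartAt_symm hx).mdifferentiableAt (by simp)
  have hφ : MDifferentiableAt 𝓘(ℝ, E) 𝓘(ℝ, E) (extChartAt 𝓘(ℝ, E) (f x₀))
      (f ((extChartAt 𝓘(ℝ, F) x₀).symm x)) :=
    mdifferentiableAt_extChartAt (by rwa [← extChartAt_source 𝓘(ℝ, E)])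
  rw [← mfderiv_eq_fderiv, writtenInExtChartAt, mfderiv_comp x hφ ((hf _).comp x hκ),
    mfderiv_comp x (hf _) hκ]
  exact finrank_range_comp_comp_le (V₁ := F) (V₂ := F) (V₃ := E) (V₄ := E) _ _ _

theorem surjective_mfderiv_of_rank_le_of_nhds_le_map [FiniteDimensional ℝ F]
    (hf : ContMDiff 𝓘(ℝ, F) 𝓘(ℝ, E) 1 f)
    (hrank : ∀ x, Module.finrank ℝ (mfderiv 𝓘(ℝ, F) 𝓘(ℝ, E) f x).range ≤
      Module.finrank ℝ (mfderiv 𝓘(ℝ, F) 𝓘(ℝ, E) f x₀).range)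
    (hopen : nhds (f x₀) ≤ Filter.map f (nhds x₀)) :
    Function.Surjective (mfderiv 𝓘(ℝ, F) 𝓘(ℝ, E) f x₀) := by
  have : CompleteSpace F := FiniteDimensional.complete ℝ F
  have hmdiff : MDifferentiable 𝓘(ℝ, F) 𝓘(ℝ, E) f := hf.mdifferentiable one_ne_zero
  have hderiv := fderiv_writtenInExtChartAt (hmdiff x₀)
  rw [← hderiv]
  refine surjective_fderiv_of_rank_le_of_nhds_le_map (E := E) (F := F)
    (contDiffAt_writtenInExtChartAt (hf x₀)) ?_ (nhds_le_map_writtenInExtChartAt hopen)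
  filter_upwards [eventually_finrank_fderiv_writtenInExtChartAt_le hmdiff] with x hx
  rw [hderiv]
  exact hx.trans (hrank _)

end Submersion

section OrbitMap

variable {E : Type*} [NormedAddCommGroup E] [NormedSpace ℝ E]
  {M : Type*} [TopologicalSpace M] [ChartedSpace E M]
  {F : Type*} [NormedAddCommGroup F] [NormedSpace ℝ F]
  {H : Type*} [TopologicalSpace H] [ChartedSpace F H] [Group H] [MulAction H M]
  [ContMDiffSMul 𝓘(ℝ, F) 𝓘(ℝ, E) ∞ H M]

theorem contMDiff_orbitMap (P₀ : M) :
    ContMDiff 𝓘(ℝ, F) 𝓘(ℝ, E) ∞ (fun h : H ↦ h • P₀) :=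
  contMDiff_id.smul contMDiff_const

variable [LieGroup 𝓘(ℝ, F) ∞ H]

theorem finrank_range_mfderiv_orbitMap_le [FiniteDimensional ℝ E] (P₀ : M) (h k : H) :
    Module.finrank ℝ (mfderiv 𝓘(ℝ, F) 𝓘(ℝ, E) (fun h : H ↦ h • P₀) h).range ≤
      Module.finrank ℝ (mfderiv 𝓘(ℝ, F) 𝓘(ℝ, E) (fun h : H ↦ h • P₀) k).range := by
  have hfac : (fun l : H ↦ l • P₀) =
      (fun p : M ↦ (h * k⁻¹) • p) ∘ (fun l : H ↦ l • P₀) ∘ fun l : H ↦ k * h⁻¹ * l := by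
    funext l
    simp only [Function.comp_apply, smul_smul]
    group
  have hk : k * h⁻¹ * h = k := inv_mul_cancel_right k h
  have hleft : MDifferentiable 𝓘(ℝ, F) 𝓘(ℝ, F) fun l : H ↦ k * h⁻¹ * l :=
    (contMDiff_mul_left (I := 𝓘(ℝ, F)) (n := ∞)).mdifferentiable (by simp)
  have horbit : MDifferentiable 𝓘(ℝ, F) 𝓘(ℝ, E) fun l : H ↦ l • P₀ :=
    (contMDiff_orbitMap P₀).mdifferentiable (by simp)
  have hsmul : MDifferentiable 𝓘(ℝ, E) 𝓘(ℝ, E) fun p : M ↦ (h * k⁻¹) • p :=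
    (ContMDiffSMul.contMDiff_const_smul (I := 𝓘(ℝ, F)) (n := ∞) (h * k⁻¹)).mdifferentiable
      (by simp)
  conv_lhs => rw [hfac]
  rw [mfderiv_comp h (hsmul _) ((horbit.comp hleft) h), mfderiv_comp h (horbit _) (hleft h)]
  refine (finrank_range_comp_comp_le (V₁ := F) (V₂ := F) (V₃ := E) (V₄ := E) _ _ _).trans ?_
  rw [hk]
  exact le_rfl

variable [FiniteDimensional ℝ E] [FiniteDimensional ℝ F] [SecondCountableTopology H] [T2Space M]
  [MulAction.IsPretransitive H M] [IsManifold 𝓘(ℝ, E) ∞ M]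

theorem surjective_mfderiv_orbitMap (P₀ : M) (h : H) :
    Function.Surjective (mfderiv 𝓘(ℝ, F) 𝓘(ℝ, E) (fun h : H ↦ h • P₀) h) := by
  have : LocallyCompactSpace M := ChartedSpace.locallyCompactSpace E M
  have : LocallyCompactSpace H := ChartedSpace.locallyCompactSpace F H
  have : IsTopologicalGroup H := topologicalGroup_of_lieGroup 𝓘(ℝ, F) ∞
  have : ContinuousSMul H M := ContMDiffSMul.continuousSMul (I := 𝓘(ℝ, F)) (I' := 𝓘(ℝ, E)) ∞
  have hopen : IsOpenMap (fun h : H ↦ h • P₀) := isOpenMap_smul_of_sigmaCompact P₀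
  exact surjective_mfderiv_of_rank_le_of_nhds_le_map ((contMDiff_orbitMap P₀).of_le (by simp))
    (fun k ↦ finrank_range_mfderiv_orbitMap_le P₀ k h) (hopen.nhds_le h)

theorem contMDiff_of_contMDiff_comp_orbitMap {E' : Type*} [NormedAddCommGroup E']
    [NormedSpace ℝ E'] {X : Type*} [TopologicalSpace X] [ChartedSpace E' X] {f : M → X} (P₀ : M)
    (hf : ContMDiff 𝓘(ℝ, F) 𝓘(ℝ, E') ∞ (fun h : H ↦ f (h • P₀))) :
    ContMDiff 𝓘(ℝ, E) 𝓘(ℝ, E') ∞ f := by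
  have : CompleteSpace F := FiniteDimensional.complete ℝ F
  intro p
  obtain ⟨h, rfl⟩ := MulAction.exists_smul_eq H P₀ p
  obtain ⟨s, hs, -, hsec⟩ := exists_contMDiffAt_section (contMDiff_orbitMap (E := E) (F := F) P₀ h)
    (surjective_mfderiv_orbitMap P₀ h)
  refine ((hf _).comp (h • P₀) hs).congr_of_eventuallyEq ?_
  filter_upwards [hsec] with q hq
  exact congrArg f hq.symm

end OrbitMap

section Potential

variable {E : Type*} [NormedAddCommGroup E] [NormedSpace ℝ E]
  {M : Type*} [TopologicalSpace M] [ChartedSpace E M]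
  {H : Type*} [Group H] [MulAction H M]

/-- The descent of the character `lam` along the orbit map `h ↦ h • P₀`, so that `M_t` is the level
set `f = t` and `g_λ = f² g₀`. It is characterised by its equivariance, which also makes sense
before `lam` is known to be a homomorphism. -/
structure IsPotential (E : Type*) [NormedAddCommGroup E] [NormedSpace ℝ E]
    {M : Type*} [TopologicalSpace M] [ChartedSpace E M] {H : Type*} [Group H] [MulAction H M]
    (f : M → ℝ) (lam : H → ℝ) (P₀ : M) : Prop where
  contMDiff : ContMDiff 𝓘(ℝ, E) 𝓘(ℝ, ℝ) ∞ f
  pos : ∀ p, 0 < f p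
  map_smul : ∀ (h : H) (p : M), f (h • p) = lam h * f p
  map_base : f P₀ = 1

theorem exists_isPotential_of_relativeInvariant [MulAction.IsPretransitive H M] {lam : H → ℝ}
    {w : M → ℝ} {n : ℕ} (hn : n ≠ 0) (hlam : ∀ h, 0 < lam h) (hw : ContMDiff 𝓘(ℝ, E) 𝓘(ℝ, ℝ) ∞ w)
    (hw_smul : ∀ (h : H) (p : M), w p = lam h ^ n * w (h • p)) (hw0 : ∃ p, w p ≠ 0) (P₀ : M) :
    ∃ f : M → ℝ, IsPotential E f lam P₀ := by
  have hne : ∀ p, w p ≠ 0 := by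
    intro p hp
    obtain ⟨p₁, hp₁⟩ := hw0
    obtain ⟨h, rfl⟩ := MulAction.exists_smul_eq H p₁ p
    exact hp₁ (by rw [hw_smul h, hp, mul_zero])
  have hquot (h : H) (p : M) : w P₀ / w (h • p) = lam h ^ n * (w P₀ / w p) := by
    rw [hw_smul h p]
    field_simp [hne, (hlam h).ne']
  have hquot_pos (p : M) : 0 < w P₀ / w p := by
    obtain ⟨h, rfl⟩ := MulAction.exists_smul_eq H P₀ p
    rw [hquot, div_self (hne P₀), mul_one]
    exact pow_pos (hlam h) n
  refine ⟨fun p ↦ (w P₀ / w p) ^ (n : ℝ)⁻¹, fun p ↦ ?_,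
    fun p ↦ Real.rpow_pos_of_pos (hquot_pos p) _, fun h p ↦ ?_, ?_⟩
  · have hroot : ContDiffAt ℝ ∞ (fun x : ℝ ↦ (w P₀ / x) ^ (n : ℝ)⁻¹) (w p) :=
      (contDiffAt_const.div contDiffAt_id (hne p)).rpow_const_of_ne (hquot_pos p).ne'
    exact hroot.contMDiffAt.comp p (hw p)
  · rw [hquot, Real.mul_rpow (pow_nonneg (hlam h).le n) (hquot_pos p).le,
      Real.pow_rpow_inv_natCast (hlam h).le hn]
  · rw [div_self (hne P₀), Real.one_rpow]

namespace IsPotential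

variable {f : M → ℝ} {lam : H → ℝ} {P₀ : M}

theorem map_smul_base (hf : IsPotential E f lam P₀) (h : H) : f (h • P₀) = lam h := by
  rw [hf.map_smul, hf.map_base, mul_one]

theorem map_mul (hf : IsPotential E f lam P₀) (h k : H) : lam (h * k) = lam h * lam k := by
  rw [← hf.map_smul_base, mul_smul, hf.map_smul, hf.map_smul_base]

theorem eq_one_of_mem_stabilizer (hf : IsPotential E f lam P₀) {h : H}
    (hh : h ∈ MulAction.stabilizer H P₀) : lam h = 1 := by
  rw [← hf.map_smul_base, MulAction.mem_stabilizer_iff.1 hh, hf.map_base]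

theorem contMDiff_character {F : Type*} [NormedAddCommGroup F] [NormedSpace ℝ F]
    [TopologicalSpace H] [ChartedSpace F H] [ContMDiffSMul 𝓘(ℝ, F) 𝓘(ℝ, E) ∞ H M]
    (hf : IsPotential E f lam P₀) : ContMDiff 𝓘(ℝ, F) 𝓘(ℝ, ℝ) ∞ lam := by
  simpa only [Function.comp_def, hf.map_smul_base] using
    hf.contMDiff.comp (contMDiff_orbitMap (F := F) (H := H) P₀)

variable [IsManifold 𝓘(ℝ, E) ∞ M] [MulAction.IsPretransitive H M]

theorem isRescaling_iff (hf : IsPotential E f lam P₀) {g₀ g : PseudoRiemannianMetric E M} :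
    IsRescaling g₀ lam P₀ g ↔ ∀ p, g.inner p = f p ^ 2 • g₀.inner p := by
  refine ⟨fun hg p ↦ ?_, ?_⟩
  · obtain ⟨h, rfl⟩ := MulAction.exists_smul_eq H P₀ p
    rw [hf.map_smul_base]
    exact hg _ _ ⟨h, rfl, rfl⟩
  · rintro hg _ _ ⟨h, rfl, rfl⟩
    exact (hg (h • P₀)).trans (by rw [hf.map_smul_base])

theorem existsUnique_isRescaling (hf : IsPotential E f lam P₀) (g₀ : PseudoRiemannianMetric E M) :
    ∃! g : PseudoRiemannianMetric E M, IsRescaling g₀ lam P₀ g := by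
  simp only [hf.isRescaling_iff]
  exact ⟨g₀.rescale (fun p ↦ f p ^ 2) (hf.contMDiff.pow 2) fun p ↦ (pow_pos (hf.pos p) 2).ne',
    fun _ ↦ rfl, fun _ hg ↦ PseudoRiemannianMetric.ext_inner hg⟩

end IsPotential

end Potential

section Structures

variable {E : Type*} [NormedAddCommGroup E] [NormedSpace ℝ E]
  {M : Type*} [TopologicalSpace M] [ChartedSpace E M] [IsManifold 𝓘(ℝ, E) ∞ M]
  {F : Type*} [NormedAddCommGroup F] [NormedSpace ℝ F]
  {H : Type*} [TopologicalSpace H] [ChartedSpace F H] [Group H] [MulAction H M]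
  {g₀ g : PseudoRiemannianMetric E M} {lam : H → ℝ} {P₀ : M} {f : M → ℝ}

theorem PseudoRiemannianMetric.PullbackEqSq.of_conformal {T : M → M} {c d : ℝ}
    (h : g₀.PullbackEqSq T c) (hg : ∀ p, g.inner p = f p • g₀.inner p)
    (hf : ∀ p, f (T p) * c ^ 2 = d ^ 2 * f p) : g.PullbackEqSq T d := by
  intro p v w
  have happly (q : M) (x y : TangentSpace 𝓘(ℝ, E) q) :
      g.inner q x y = f q * g₀.inner q x y := by
    rw [hg]
    rfl
  rw [happly, happly, h p v w, ← mul_assoc, hf, mul_assoc]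

theorem HasHomothetyCharacter.isHomothetyHomogeneous (hg : HasHomothetyCharacter F g lam) :
    g.IsHomothetyHomogeneous := by
  have := hg.smooth_action
  have := hg.transitive
  intro p q
  obtain ⟨h, hh⟩ := MulAction.exists_smul_eq H p q
  exact ⟨⟨MulAction.toPerm h, ContMDiffSMul.contMDiff_const_smul (I := 𝓘(ℝ, F)) h,
    ContMDiffSMul.contMDiff_const_smul (I := 𝓘(ℝ, F)) h⁻¹⟩, ⟨lam h, hg.pos h, hg.homothety h⟩, hh⟩

theorem IsPStructure.hasHomothetyCharacter (hP : IsPStructure F g₀ lam P₀)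
    (hf : IsPotential E f lam P₀) (hg : IsRescaling g₀ lam P₀ g) :
    HasHomothetyCharacter F g lam := by
  have := hP.transitive
  refine ⟨hP.smooth_action, hP.transitive, hP.effective, hP.pos, fun h ↦ ?_⟩
  refine (hP.isometry h).of_conformal (hf.isRescaling_iff.1 hg) fun p ↦ ?_
  rw [hf.map_smul]
  ring

theorem HasHomothetyCharacter.isPStructure (hg : HasHomothetyCharacter F g lam)
    (hf : IsPotential E f lam P₀) (hnt : ∃ h, lam h ≠ 1)
    (hg₀ : ∀ p, g₀.inner p = (f p ^ 2)⁻¹ • g.inner p) : IsPStructure F g₀ lam P₀ := by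
  have := hg.smooth_action
  refine ⟨hg.smooth_action, hg.transitive, hg.effective, fun h ↦ ?_, hg.pos, hf.map_mul,
    hf.contMDiff_character, hnt, fun h ↦ hf.eq_one_of_mem_stabilizer⟩
  refine (hg.homothety h).of_conformal hg₀ fun p ↦ ?_
  rw [hf.map_smul]
  field_simp [(hg.pos h).ne', (hf.pos p).ne']

theorem IsPStructure.lam_eq_of_smul_eq (hP : IsPStructure F g₀ lam P₀) {h k : H}
    (hk : h • P₀ = k • P₀) : lam h = lam k := by
  have hstab : k⁻¹ * h ∈ MulAction.stabilizer H P₀ := by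
    rw [MulAction.mem_stabilizer_iff, mul_smul, hk, inv_smul_smul]
  rw [← mul_inv_cancel_left k h, hP.map_mul, hP.isotropy _ hstab, mul_one]

variable [FiniteDimensional ℝ E]

theorem HasHomothetyCharacter.exists_isPotential (hg : HasHomothetyCharacter F g lam)
    (hvsi : ¬ g.IsVSI) (P₀ : M) : ∃ f : M → ℝ, IsPotential E f lam P₀ := by
  have := hg.smooth_action
  have := hg.transitive
  simp only [PseudoRiemannianMetric.IsVSI, not_forall] at hvsi
  obtain ⟨w, hw⟩ := hvsi
  have hsmul (h : H) (p : M) : g.weylScalar w p =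
      lam h ^ (2 * (w.pairs - w.factors)) * g.weylScalar w (h • p) := by
    rw [pow_mul]
    exact (hg.homothety h).weylScalar_eq
      (ContMDiffSMul.contMDiff_const_smul (I := 𝓘(ℝ, F)) h) (hg.pos h).ne' w p
  exact exists_isPotential_of_relativeInvariant
    (mul_ne_zero two_ne_zero w.pairs_sub_factors_pos.ne') hg.pos (g.contMDiff_weylScalar w) hsmul
    hw P₀

theorem HasHomothetyCharacter.exists_isPStructure (hg : HasHomothetyCharacter F g lam)
    (hnt : ∃ h, lam h ≠ 1) (hvsi : ¬ g.IsVSI) (P₀ : M) :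
    ∃ g₀ : PseudoRiemannianMetric E M, IsPStructure F g₀ lam P₀ ∧ IsRescaling g₀ lam P₀ g := by
  have := hg.transitive
  obtain ⟨f, hf⟩ := hg.exists_isPotential hvsi P₀
  have hf2 (p : M) : f p ^ 2 ≠ 0 := (pow_pos (hf.pos p) 2).ne'
  refine ⟨g.rescale (fun p ↦ (f p ^ 2)⁻¹) ((hf.contMDiff.pow 2).inv₀ hf2)
    fun p ↦ inv_ne_zero (hf2 p), hg.isPStructure hf hnt fun _ ↦ rfl,
    hf.isRescaling_iff.2 fun p ↦ ?_⟩
  exact (smul_inv_smul₀ (hf2 p) (g.inner p)).symm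

theorem IsPStructure.exists_isPotential [FiniteDimensional ℝ F] [LieGroup 𝓘(ℝ, F) ∞ H] [T2Space M]
    [SecondCountableTopology H] (hP : IsPStructure F g₀ lam P₀) :
    ∃ f : M → ℝ, IsPotential E f lam P₀ := by
  have := hP.smooth_action
  have := hP.transitive
  choose s hs using MulAction.exists_smul_eq H P₀
  have hbase (h : H) : lam (s (h • P₀)) = lam h := hP.lam_eq_of_smul_eq (hs _)
  refine ⟨fun p ↦ lam (s p), contMDiff_of_contMDiff_comp_orbitMap (F := F) (H := H) P₀ ?_,
    fun p ↦ hP.pos _, fun h p ↦ ?_, ?_⟩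
  · simpa only [hbase] using hP.smooth_character
  · rw [← hP.map_mul, ← hbase (h * s p), mul_smul, hs]
  · exact hP.isotropy _ (hs P₀)

end Structures

theorem theorem1p8_general
    {E : Type*} [NormedAddCommGroup E] [NormedSpace ℝ E] [FiniteDimensional ℝ E]
    {M : Type*} [TopologicalSpace M] [ChartedSpace E M] [IsManifold 𝓘(ℝ, E) ∞ M] [T2Space M]
    {F : Type*} [NormedAddCommGroup F] [NormedSpace ℝ F] [FiniteDimensional ℝ F]
    {H : Type*} [TopologicalSpace H] [ChartedSpace F H] [Group H] [LieGroup 𝓘(ℝ, F) ∞ H]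
    [SecondCountableTopology H] [MulAction H M] (lam : H → ℝ) (P₀ : M) :
    (∀ g₀ : PseudoRiemannianMetric E M, IsPStructure F g₀ lam P₀ →
      (∃! g : PseudoRiemannianMetric E M, IsRescaling g₀ lam P₀ g) ∧
      ∀ g : PseudoRiemannianMetric E M, IsRescaling g₀ lam P₀ g →
        g.IsHomothetyHomogeneous ∧ HasHomothetyCharacter F g lam) ∧
    (∀ g : PseudoRiemannianMetric E M, HasHomothetyCharacter F g lam → (∃ h, lam h ≠ 1) →
      ¬ g.IsVSI →
      ∃ g₀ : PseudoRiemannianMetric E M, IsPStructure F g₀ lam P₀ ∧ IsRescaling g₀ lam P₀ g) := by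
  refine ⟨fun g₀ hP ↦ ?_, fun g hg hnt hvsi ↦ hg.exists_isPStructure hnt hvsi P₀⟩
  have := hP.transitive
  obtain ⟨f, hf⟩ := hP.exists_isPotential
  refine ⟨hf.existsUnique_isRescaling g₀, fun g hg ↦ ?_⟩
  have hchar := hP.hasHomothetyCharacter hf hg
  exact ⟨hchar.isHomothetyHomogeneous, hchar⟩

theorem theorem1p8
    {E : Type*} [NormedAddCommGroup E] [NormedSpace ℝ E] [FiniteDimensional ℝ E]
    {M : Type*} [TopologicalSpace M] [ChartedSpace E M] [IsManifold 𝓘(ℝ, E) ∞ M]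
    [T2Space M] [SecondCountableTopology M] [ConnectedSpace M]
    {F : Type*} [NormedAddCommGroup F] [NormedSpace ℝ F] [FiniteDimensional ℝ F]
    {H : Type*} [TopologicalSpace H] [ChartedSpace F H] [Group H] [LieGroup 𝓘(ℝ, F) ∞ H]
    [T2Space H] [SecondCountableTopology H] [ConnectedSpace H] [MulAction H M]
    (lam : H → ℝ) (P₀ : M) :
    (∀ g₀ : PseudoRiemannianMetric E M, IsPStructure F g₀ lam P₀ →
      (∃! g : PseudoRiemannianMetric E M, IsRescaling g₀ lam P₀ g) ∧
      ∀ g : PseudoRiemannianMetric E M, IsRescaling g₀ lam P₀ g →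
        g.IsHomothetyHomogeneous ∧ HasHomothetyCharacter F g lam) ∧
    (∀ g : PseudoRiemannianMetric E M, HasHomothetyCharacter F g lam → (∃ h, lam h ≠ 1) →
      ¬ g.IsVSI →
      ∃ g₀ : PseudoRiemannianMetric E M, IsPStructure F g₀ lam P₀ ∧ IsRescaling g₀ lam P₀ g) :=
  theorem1p8_general lam P₀
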